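/- Write $\mathbb T^1=\mathbb R/\mathbb Z$ and $\mathbb T^2=\mathbb R^2/\mathbb Z^2$, and let $\lambda$ and $\mu$ be the Lebesgue probability measures on $\mathbb T^1$ and $\mathbb T^2$. For $\rho>0$ let $\Omega_\rho=\{(z_1,z_2)\in\mathbb C^2: |\operatorname{Im} z_1|<\rho,\ |\operatorname{Im} z_2|<\rho\}$, and let $C^\omega_\rho(\mathbb T^2)$ be the space of $\mathbb Z^2$-periodic real-analytic functions $f:\mathbb R^2\to\mathbb R$ that extend holomorphically to $\Omega_\rho$ with $\|f\|_\rho:=\sup_{\Omega_\rho}|f|<\infty$. Let $\mathrm{Diff}^\omega_\rho(\mathbb T^2,\mu)$ be the set of $\mu$-preserving real-analytic diffeomorphisms $F$ of $\mathbb T^2$, homotopic to the identity, that have a lift $(x_1,x_2)\mapsto(x_1+f_1(x_1,x_2),\,x_2+f_2(x_1,x_2))$ to $\mathbb R^2$ with $f_1,f_2\in C^\omega_\rho(\mathbb T^2)$, and let $d_\rho(F,G)=\max_{i=1,2}\inf_{n\in\mathbb Z}\|f_i-g_i+n\|_\rho$, where $g_1,g_2$ are the corresponding functions of a lift of $G$.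 Let $\phi^t(x_1,x_2)=(x_1+t,x_2)$ on $\mathbb T^2$. **Theorem.** There exist an irrational Liouville number $\alpha$ and a real-analytic diffeomorphism $T:\mathbb T^2\to\mathbb T^2$ such that 1. $T$ preserves $\mu$ and is uniquely ergodic (it has exactly one invariant Borel probability measure); 2. $T$ is entire: it has a lift $x\mapsto x+f(x)$ to $\mathbb R^2$, with $f$ real-analytic and $\mathbb Z^2$-periodic, that extends to a holomorphic map $\mathbb C^2\to\mathbb C^2$; moreover $T\in\mathrm{Diff}^\omega_\rho(\mathbb T^2,\mu)$ for every $\rho>0$; 3. $(\mathbb T^2,\mu,T)$ is metrically isomorphic (isomorphic modulo null sets) to $(\mathbb T^1,\lambda,R_\alpha)$, where $R_\alpha(x)=x+\alpha$; 4. there are rational numbers $\alpha_n\in[0,1)$ with $\alpha_n\to\alpha$, and $H_n\in\bigcap_{\rho>0}\mathrm{Diff}^\omega_\rho(\mathbb T^2,\mu)$, such that $T_n:=H_n^{-1}\circ\phi^{\alpha_n}\circ H_n$ belongs to $\mathrm{Diff}^\omega_\rho(\mathbb T^2,\mu)$ for all $n$ and all $\rho>0$, and $d_\rho(T_n,T)\to0$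 as $n\to\infty$ for every $\rho>0$. -/

import Mathlib

open MeasureTheory Filter Topology
open scoped ENNReal

noncomputable section

namespace AnalyticTorus

/-- The two-torus `ℝ² / ℤ²`, as the product of two circles `ℝ / ℤ`. Its `volume` is the product of
the Lebesgue probability measures of the two circles. -/
abbrev Torus : Type := UnitAddCircle × UnitAddCircle

/-- The covering map `ℝ² → ℝ² / ℤ²`. -/
def proj (x : ℝ × ℝ) : Torus := ((x.1 : UnitAddCircle), (x.2 : UnitAddCircle))

/-- A map of the torus is real-analytic if it has a lift to `ℝ²` which is real-analytic
(every continuous self-map of the torus has a lift to `ℝ²`, and the covering map is a local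
real-analytic isomorphism). -/
def IsRealAnalyticMap (F : Torus → Torus) : Prop :=
  ∃ L : ℝ × ℝ → ℝ × ℝ, AnalyticOnNhd ℝ L Set.univ ∧ ∀ x, proj (L x) = F (proj x)

/-- Real-analytic diffeomorphisms of the torus. -/
def IsAnalyticDiffeo (F : Torus ≃ Torus) : Prop :=
  IsRealAnalyticMap F ∧ IsRealAnalyticMap F.symm

/-- `ℤ²`-periodic real functions on `ℝ²`. -/
def IsPeriodic (f : ℝ × ℝ → ℝ) : Prop :=
  ∀ (x : ℝ × ℝ) (m n : ℤ), f (x.1 + m, x.2 + n) = f x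

/-- The tube `Ω_ρ = {(z₁, z₂) ∈ ℂ² : |Im z₁| < ρ and |Im z₂| < ρ}`. -/
def tube (ρ : ℝ) : Set (ℂ × ℂ) := {z | |z.1.im| < ρ ∧ |z.2.im| < ρ}

/-- `g` agrees on `ℝ² ⊆ ℂ²` with the real function `f`. -/
def Extends (g : ℂ × ℂ → ℂ) (f : ℝ × ℝ → ℝ) : Prop :=
  ∀ x : ℝ × ℝ, g ((x.1 : ℂ), (x.2 : ℂ)) = (f x : ℂ)

/-- The norm `‖f‖_ρ = sup_{Ω_ρ} |f|` of (the holomorphic extension to `Ω_ρ` of) a function `f` on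
`ℝ²`. For `ρ > 0` a holomorphic extension is unique on `Ω_ρ` if it exists, so that the infimum is
over at most one value; it is `∞` if there is no holomorphic extension to `Ω_ρ`. -/
def normRho (ρ : ℝ) (f : ℝ × ℝ → ℝ) : ℝ≥0∞ :=
  ⨅ (g : ℂ × ℂ → ℂ) (_ : DifferentiableOn ℂ g (tube ρ) ∧ Extends g f), ⨆ z ∈ tube ρ, ‖g z‖ₑ

/-- The space `C^ω_ρ(𝕋²)` of `ℤ²`-periodic real-analytic functions on `ℝ²` which extend to a
bounded holomorphic function on `Ω_ρ`. -/
def analyticSpace (ρ : ℝ) : Set (ℝ × ℝ → ℝ) :=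
  {f | IsPeriodic f ∧ AnalyticOnNhd ℝ f Set.univ ∧ normRho ρ f < ∞}

/-- `F` has the lift `(x₁, x₂) ↦ (x₁ + f₁(x₁, x₂), x₂ + f₂(x₁, x₂))` to `ℝ²`, where `f₁` and `f₂`
are real-analytic and `ℤ²`-periodic. Lifts of this form exist exactly for the real-analytic maps
that are homotopic to the identity; `f₁` and `f₂` are unique up to adding integers. -/
structure IsDisplacement (F : Torus → Torus) (f₁ f₂ : ℝ × ℝ → ℝ) : Prop where
  analytic₁ : AnalyticOnNhd ℝ f₁ Set.univ
  analytic₂ : AnalyticOnNhd ℝ f₂ Set.univ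
  periodic₁ : IsPeriodic f₁
  periodic₂ : IsPeriodic f₂
  lift : ∀ x : ℝ × ℝ, proj (x.1 + f₁ x, x.2 + f₂ x) = F (proj x)

/-- The set `Diff^ω_ρ(𝕋², μ)` of Lebesgue-measure-preserving real-analytic diffeomorphisms of the
torus, homotopic to the identity, with lift `x ↦ x + f(x)` for some `f₁, f₂ ∈ C^ω_ρ(𝕋²)`. -/
def DiffRho (ρ : ℝ) : Set (Torus ≃ Torus) :=
  {F | IsAnalyticDiffeo F ∧ MeasurePreserving F volume volume ∧
    ∃ f₁ f₂, IsDisplacement F f₁ f₂ ∧ f₁ ∈ analyticSpace ρ ∧ f₂ ∈ analyticSpace ρ}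

/-- The distance `d_ρ(F, G) = max_{i = 1, 2} inf_{n ∈ ℤ} ‖f_i - g_i + n‖_ρ`. The value inside the
outer infimum does not depend on the choice of the lifts. -/
def distRho (ρ : ℝ) (F G : Torus ≃ Torus) : ℝ≥0∞ :=
  ⨅ (f₁ : ℝ × ℝ → ℝ) (f₂ : ℝ × ℝ → ℝ) (g₁ : ℝ × ℝ → ℝ) (g₂ : ℝ × ℝ → ℝ)
    (_ : IsDisplacement F f₁ f₂ ∧ IsDisplacement G g₁ g₂),
    max (⨅ n : ℤ, normRho ρ (fun x => f₁ x - g₁ x + n))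
      (⨅ n : ℤ, normRho ρ (fun x => f₂ x - g₂ x + n))

/-- `F` is entire: it has a lift `x ↦ x + f(x)` to `ℝ²`, with `f` periodic, that extends to a
holomorphic map on all of `ℂ²`. -/
def IsEntire (F : Torus ≃ Torus) : Prop :=
  ∃ f₁ f₂, IsDisplacement F f₁ f₂ ∧
    (∃ g : ℂ × ℂ → ℂ, Differentiable ℂ g ∧ Extends g f₁) ∧
    (∃ g : ℂ × ℂ → ℂ, Differentiable ℂ g ∧ Extends g f₂)

/-- The circle action `φ^t (x₁, x₂) = (x₁ + t, x₂)` on the torus. -/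
def flow (t : ℝ) (x : Torus) : Torus := (x.1 + (t : UnitAddCircle), x.2)

/-- The rotation `x ↦ x + α` of the circle `ℝ / ℤ`. -/
def rotation (α : ℝ) (x : UnitAddCircle) : UnitAddCircle := x + (α : UnitAddCircle)

/-- Unique ergodicity: there is exactly one invariant Borel probability measure. -/
def IsUniquelyErgodic {X : Type*} [MeasurableSpace X] (T : X → X) : Prop :=
  ∃! ν : Measure X, IsProbabilityMeasure ν ∧ MeasurePreserving T ν ν

/-- Metric isomorphism of the systems `(X, μ, T)` and `(Y, ν, S)`: there are measure-preserving
maps `K : X → Y` and `L : Y → X`, inverse to each other almost everywhere, such that `K`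
intertwines `T` and `S` almost everywhere. -/
def MetricallyIsomorphic {X Y : Type*} [MeasurableSpace X] [MeasurableSpace Y]
    (μ : Measure X) (T : X → X) (ν : Measure Y) (S : Y → Y) : Prop :=
  ∃ (K : X → Y) (L : Y → X), MeasurePreserving K μ ν ∧ MeasurePreserving L ν μ ∧
    (∀ᵐ x ∂μ, L (K x) = x) ∧ (∀ᵐ y ∂ν, K (L y) = y) ∧ ∀ᵐ x ∂μ, K (T x) = S (K x)

end AnalyticTorus

end

/-! The proof is approximation by conjugation (Anosov–Katok) with shears that have entire lifts. Put
`T_n = H_n⁻¹ ∘ φ^{a_n} ∘ H_n`, `a_n = p_n / q_n` and `H_{n+1} = h_n ∘ H_n`, where `h_n` commutes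
with the translation by `a_n`. Conjugating that translation by `H_{n+1}` still gives `T_n`
(`conj_comp_of_commutesWith`), so `T_{n+1}` and its inverse are as close as desired to `T_n` and its
inverse on a given tube once `a_{n+1}` is close enough to `a_n` (`eventually_conj_near`). No bound
on the size of `H_n` is needed. The limit `T` is entire, and fast convergence makes `α = lim a_n`
Liouville.

One block serves both ergodic properties: `h(x, y) = (x + φ(y') / q, y')` with `y' = y - φ(q x)`,
where `φ` is periodic, entire and close to the identity of the circle off a small set
(`exists_sawtooth`).

Unique ergodicity: up to a rotation and small errors, `h⁻¹` turns a horizontal circle into a curve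
`t ↦ (t, c + q t)`, which is equidistributed for large `q`. Orbit averages of `T_{n+1}` over a full
period are Riemann sums along the images of such curves under `H_n⁻¹`. Hence the averages of
finitely many test functions, over one fixed time, are uniformly close to their integrals. Being
stable under small perturbations, this passes to `T`.

Isomorphism: the first coordinate `x'` of `h(x, y)` satisfies `x' ≈ x` and, off a small set, `q x' ≈
y`. By the former, the first coordinates `K_n` of `H_n` converge uniformly to a map `K` that
intertwines `T` with the rotation by `α`; the second coordinates need not converge. By the latter,
`K_{n+1}(x)` nearly determines `x`: with `s = K_{n+1}(x)`, the point `H_n⁻¹(s, q_n s)` is close to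
`x` off a set of measure at most `2⁻ⁿ`. Borel–Cantelli then recovers almost every `x` from `K(x)`.
-/

noncomputable section

namespace AnalyticTorus

/-! ### Holomorphic functions of two variables -/

/-- The measure on `ℝ²` defining iterated circle averages. -/
def angleMeasure : Measure ℝ := (ENNReal.ofReal (2 * Real.pi)⁻¹) • volume.restrict (Set.Ioc 0 (2 * Real.pi))

instance : IsFiniteMeasure angleMeasure := by
  unfold angleMeasure
  exact Measure.smul_finite _ ENNReal.ofReal_ne_top

lemma integral_angleMeasure (f : ℂ → ℂ) (c : ℂ) :
    ∫ θ, f (c + Circle.exp θ) ∂angleMeasure = Real.circleAverage f c 1 := by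
  have h2 : (0 : ℝ) ≤ 2 * Real.pi := by positivity
  rw [angleMeasure, integral_smul_measure, Real.circleAverage_def,
    intervalIntegral.integral_of_le h2, ENNReal.toReal_ofReal (by positivity)]
  simp [circleMap, Circle.coe_exp]

/-- Integration over the torus of angles, as a continuous linear functional. -/
def angleIntegral : C(Circle × Circle, ℂ) →L[ℂ] ℂ :=
  LinearMap.mkContinuous
    { toFun := fun F => ∫ p, F (Circle.exp p.1, Circle.exp p.2) ∂(angleMeasure.prod angleMeasure)
      map_add' := fun F G => by
        have hint : ∀ F : C(Circle × Circle, ℂ),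
            Integrable (fun p : ℝ × ℝ => F (Circle.exp p.1, Circle.exp p.2))
              (angleMeasure.prod angleMeasure) := fun F =>
          Integrable.of_bound (by fun_prop) ‖F‖ (ae_of_all _ fun p => F.norm_coe_le_norm _)
        exact integral_add (hint F) (hint G)
      map_smul' := fun c F => integral_const_mul c _ }
    ((angleMeasure.prod angleMeasure).real Set.univ)
    (fun F => by
      rw [mul_comm]
      exact norm_integral_le_of_norm_le_const (ae_of_all _ fun p => F.norm_coe_le_norm _))

lemma angleIntegral_apply (F : C(Circle × Circle, ℂ)) :
    angleIntegral F = ∫ s, ∫ t, F (Circle.exp s, Circle.exp t) ∂angleMeasure ∂angleMeasure := by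
  have hint : Integrable (fun p : ℝ × ℝ => F (Circle.exp p.1, Circle.exp p.2))
      (angleMeasure.prod angleMeasure) :=
    Integrable.of_bound (by fun_prop) ‖F‖ (ae_of_all _ fun p => F.norm_coe_le_norm _)
  exact integral_prod _ hint

lemma eval_ringInverse {X : Type*} [TopologicalSpace X] [CompactSpace X] (F : C(X, ℂ))
    (hF : ∀ x, F x ≠ 0) (x : X) : (Ring.inverse F) x = (F x)⁻¹ := by
  have hu : IsUnit F := ContinuousMap.isUnit_iff_forall_ne_zero F |>.2 hF
  have := congrArg (fun G : C(X, ℂ) => G x) (Ring.inverse_mul_cancel F hu)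
  simp only [ContinuousMap.mul_apply, ContinuousMap.one_apply] at this
  exact eq_inv_of_mul_eq_one_left this

/-- Osgood's lemma on `ℂ²`: a continuous function which is holomorphic in each variable is
analytic. -/
theorem analyticOnNhd_of_separately {f : ℂ × ℂ → ℂ} (hf : Continuous f)
    (h₁ : ∀ b, Differentiable ℂ fun a => f (a, b)) (h₂ : ∀ a, Differentiable ℂ fun b => f (a, b)) :
    AnalyticOnNhd ℂ f Set.univ := by
  rintro ⟨c₁, c₂⟩ -
  -- The denominators of the Cauchy kernel are points of the Banach algebra `C(Circle × Circle, ℂ)`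
  -- depending affinely on `w`. Inversion is analytic at units and integration is linear, so the
  -- double Cauchy integral is analytic in `w` without differentiation under the integral.
  let E₁ : C(Circle × Circle, ℂ) := ⟨fun p => p.1, by fun_prop⟩
  let E₂ : C(Circle × Circle, ℂ) := ⟨fun p => p.2, by fun_prop⟩
  let A : C(Circle × Circle, ℂ) := ⟨fun p => p.1 * p.2 * f (c₁ + p.1, c₂ + p.2), by fun_prop⟩
  let B₁ : ℂ × ℂ → C(Circle × Circle, ℂ) := fun w => E₁ - (w.1 - c₁) • (1 : C(Circle × Circle, ℂ))
  let B₂ : ℂ × ℂ → C(Circle × Circle, ℂ) := fun w => E₂ - (w.2 - c₂) • (1 : C(Circle × Circle, ℂ))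
  have hB₁ : AnalyticAt ℂ B₁ (c₁, c₂) := by
    refine analyticAt_const.sub (AnalyticAt.fun_smul ?_ analyticAt_const)
    exact analyticAt_fst.sub analyticAt_const
  have hB₂ : AnalyticAt ℂ B₂ (c₁, c₂) := by
    refine analyticAt_const.sub (AnalyticAt.fun_smul ?_ analyticAt_const)
    exact analyticAt_snd.sub analyticAt_const
  have hu₁ : IsUnit (B₁ (c₁, c₂)) := by
    rw [ContinuousMap.isUnit_iff_forall_ne_zero]
    intro x
    simp [B₁, E₁]
  have hu₂ : IsUnit (B₂ (c₁, c₂)) := by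
    rw [ContinuousMap.isUnit_iff_forall_ne_zero]
    intro x
    simp [B₂, E₂]
  have han : AnalyticAt ℂ (fun w => angleIntegral (A * Ring.inverse (B₁ w) * Ring.inverse (B₂ w)))
      (c₁, c₂) := by
    refine (angleIntegral.analyticAt _).comp ?_
    refine (analyticAt_const.mul ?_).mul ?_
    · exact (analyticOnNhd_inverse _ hu₁).fun_comp hB₁
    · exact (analyticOnNhd_inverse _ hu₂).fun_comp hB₂
  refine han.congr ?_
  have hnh : ∀ᶠ w : ℂ × ℂ in 𝓝 (c₁, c₂), w ∈ Metric.ball c₁ 1 ×ˢ Metric.ball c₂ 1 :=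
    prod_mem_nhds (Metric.ball_mem_nhds _ one_pos) (Metric.ball_mem_nhds _ one_pos)
  filter_upwards [hnh] with w hw
  obtain ⟨w₁, w₂⟩ := w
  obtain ⟨hw₁, hw₂⟩ := hw
  simp only [Metric.mem_ball, dist_eq_norm] at hw₁ hw₂
  have hne : ∀ (e : Circle) (u : ℂ), ‖u‖ < 1 → (e : ℂ) - u ≠ 0 := by
    intro e u hu h
    rw [← sub_eq_zero.1 h, Circle.norm_coe] at hu
    exact lt_irrefl _ hu
  have hval : ∀ s t : ℝ, (A * Ring.inverse (B₁ (w₁, w₂)) * Ring.inverse (B₂ (w₁, w₂)))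
      (Circle.exp s, Circle.exp t) =
      ((c₁ + Circle.exp s - c₁) / (c₁ + Circle.exp s - w₁)) •
      (((c₂ + Circle.exp t - c₂) / (c₂ + Circle.exp t - w₂)) •
        f (c₁ + Circle.exp s, c₂ + Circle.exp t)) := by
    intro s t
    rw [ContinuousMap.mul_apply, ContinuousMap.mul_apply, eval_ringInverse, eval_ringInverse]
    · have e₁ : B₁ (w₁, w₂) (Circle.exp s, Circle.exp t) = c₁ + Circle.exp s - w₁ := by
        simp [B₁, E₁]; ring
      have e₂ : B₂ (w₁, w₂) (Circle.exp s, Circle.exp t) = c₂ + Circle.exp t - w₂ := by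
        simp [B₂, E₂]; ring
      rw [e₁, e₂]
      simp only [A, ContinuousMap.coe_mk, smul_eq_mul, add_sub_cancel_left, div_eq_mul_inv]
      ring
    · intro x
      simpa [B₂, E₂] using hne x.2 _ hw₂
    · intro x
      simpa [B₁, E₁] using hne x.1 _ hw₁
  rw [angleIntegral_apply]
  simp_rw [hval, integral_smul]
  have hin : ∀ s : ℝ, ∫ t, ((c₂ + Circle.exp t - c₂) / (c₂ + Circle.exp t - w₂)) •
        f (c₁ + Circle.exp s, c₂ + Circle.exp t) ∂angleMeasure = f (c₁ + Circle.exp s, w₂) := by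
    intro s
    rw [integral_angleMeasure (fun z => ((z - c₂) / (z - w₂)) • f (c₁ + Circle.exp s, z))]
    exact DiffContOnCl.circleAverage_smul_div (h₂ _).diffContOnCl
      (by simpa [dist_eq_norm] using hw₂)
  simp_rw [hin]
  rw [integral_angleMeasure (fun z => ((z - c₁) / (z - w₁)) • f (z, w₂))]
  exact DiffContOnCl.circleAverage_smul_div (h₁ _).diffContOnCl
      (by simpa [dist_eq_norm] using hw₁)

theorem _root_.Differentiable.analyticOnNhd_prod {f : ℂ × ℂ → ℂ} (hf : Differentiable ℂ f) :
    AnalyticOnNhd ℂ f Set.univ :=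
  analyticOnNhd_of_separately hf.continuous
    (fun b => hf.comp (differentiable_id.prodMk (differentiable_const b)))
    (fun a => hf.comp ((differentiable_const a).prodMk differentiable_id))

/-- A locally uniform limit of entire functions on `ℂ²` is entire. -/
theorem differentiable_of_tendstoLocallyUniformly {F : ℕ → ℂ × ℂ → ℂ} {f : ℂ × ℂ → ℂ}
    (hF : ∀ n, Differentiable ℂ (F n)) (h : TendstoLocallyUniformly F f atTop) :
    Differentiable ℂ f := by
  -- The Weierstrass theorem in one variable applies on each complex line; Osgood's lemma assembles
  -- the two directions.
  have key : ∀ g : ℂ → ℂ × ℂ, Differentiable ℂ g → Differentiable ℂ fun a => f (g a) := by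
    intro g hg
    rw [← differentiableOn_univ]
    refine TendstoLocallyUniformlyOn.differentiableOn (φ := atTop) (F := fun n a => F n (g a))
      ?_ (Eventually.of_forall fun n => ((hF n).comp hg).differentiableOn) isOpen_univ
    rw [tendstoLocallyUniformlyOn_univ]
    exact h.comp g hg.continuous
  intro z
  refine (analyticOnNhd_of_separately ?_ (fun b => ?_) (fun a => ?_) z (Set.mem_univ z)).differentiableAt
  · exact h.continuous (Eventually.of_forall fun n => (hF n).continuous).frequently
  · exact key _ (differentiable_id.prodMk (differentiable_const b))
  · exact key _ ((differentiable_const a).prodMk differentiable_id)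

/-! ### Entire lifts of torus maps -/

lemma proj_surjective : Function.Surjective proj := by
  rintro ⟨a, b⟩
  induction a using QuotientAddGroup.induction_on with | H a => ?_
  induction b using QuotientAddGroup.induction_on with | H b => ?_
  exact ⟨(a, b), rfl⟩

lemma isOpenQuotientMap_proj : IsOpenQuotientMap proj :=
  QuotientAddGroup.isOpenQuotientMap_mk.prodMap QuotientAddGroup.isOpenQuotientMap_mk

@[simp] lemma coe_intCast (n : ℤ) : ((n : ℝ) : UnitAddCircle) = 0 :=
  (AddCircle.coe_eq_zero_iff 1).2 ⟨n, by simp⟩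

lemma exists_int_of_coe_eq {x y : ℝ} (h : (x : UnitAddCircle) = y) : ∃ n : ℤ, x = y + n := by
  rw [← sub_eq_zero, ← AddCircle.coe_sub, AddCircle.coe_eq_zero_iff] at h
  obtain ⟨n, hn⟩ := h
  refine ⟨n, ?_⟩
  simp at hn
  linarith

lemma exists_int_of_proj_eq {x y : ℝ × ℝ} (h : proj x = proj y) :
    ∃ m n : ℤ, x = (y.1 + m, y.2 + n) := by
  obtain ⟨m, hm⟩ := exists_int_of_coe_eq (congrArg Prod.fst h)
  obtain ⟨n, hn⟩ := exists_int_of_coe_eq (congrArg Prod.snd h)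
  exact ⟨m, n, Prod.ext hm hn⟩

/-- A holomorphic map of `ℂ²` that commutes with the translations by `ℤ²` and preserves `ℝ²`. -/
structure IsEntireLift (Φ : ℂ × ℂ → ℂ × ℂ) : Prop where
  differentiable : Differentiable ℂ Φ
  equivariant : ∀ (z : ℂ × ℂ) (m n : ℤ), Φ (z.1 + m, z.2 + n) = ((Φ z).1 + m, (Φ z).2 + n)
  real : ∀ x y : ℝ, (Φ (x, y)).1.im = 0 ∧ (Φ (x, y)).2.im = 0

/-- The restriction to `ℝ²` of a map of `ℂ²` that preserves `ℝ²`. -/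
def realMap (Φ : ℂ × ℂ → ℂ × ℂ) (x : ℝ × ℝ) : ℝ × ℝ :=
  ((Φ (x.1, x.2)).1.re, (Φ (x.1, x.2)).2.re)

/-- The torus map with a given lift. -/
def torusMap (Φ : ℂ × ℂ → ℂ × ℂ) (t : Torus) : Torus :=
  proj (realMap Φ (Function.surjInv proj_surjective t))

lemma continuous_realMap {Φ : ℂ × ℂ → ℂ × ℂ} (h : Continuous Φ) : Continuous (realMap Φ) := by
  unfold realMap
  fun_prop

namespace IsEntireLift

variable {Φ Ψ : ℂ × ℂ → ℂ × ℂ}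

lemma coe_realMap (h : IsEntireLift Φ) (x : ℝ × ℝ) :
    (((realMap Φ x).1 : ℂ), ((realMap Φ x).2 : ℂ)) = Φ (x.1, x.2) := by
  refine Prod.ext ?_ ?_
  · exact Complex.ext (by simp [realMap]) (by simp [(h.real x.1 x.2).1])
  · exact Complex.ext (by simp [realMap]) (by simp [(h.real x.1 x.2).2])

lemma realMap_add (h : IsEntireLift Φ) (x : ℝ × ℝ) (m n : ℤ) :
    realMap Φ (x.1 + m, x.2 + n) = ((realMap Φ x).1 + m, (realMap Φ x).2 + n) := by
  have := h.equivariant (x.1, x.2) m n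
  simp only [realMap, Complex.ofReal_add, Complex.ofReal_intCast]
  rw [this]
  simp

lemma torusMap_proj (h : IsEntireLift Φ) (x : ℝ × ℝ) :
    torusMap Φ (proj x) = proj (realMap Φ x) := by
  obtain ⟨m, n, hx⟩ := exists_int_of_proj_eq (Function.surjInv_eq proj_surjective (proj x))
  rw [torusMap, hx, h.realMap_add]
  simp [proj]

lemma comp (h : IsEntireLift Φ) (h' : IsEntireLift Ψ) : IsEntireLift (Φ ∘ Ψ) where
  differentiable := h.differentiable.comp h'.differentiable
  equivariant z m n := by simp only [Function.comp_apply, h'.equivariant, h.equivariant]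
  real x y := by
    have := h'.coe_realMap (x, y)
    simp only at this
    rw [Function.comp_apply, ← this]
    exact h.real _ _

lemma realMap_comp (h' : IsEntireLift Ψ) (x : ℝ × ℝ) :
    realMap (Φ ∘ Ψ) x = realMap Φ (realMap Ψ x) := by
  simp only [realMap, Function.comp_apply]
  rw [← h'.coe_realMap]
  rfl

lemma torusMap_comp (h : IsEntireLift Φ) (h' : IsEntireLift Ψ) (t : Torus) :
    torusMap (Φ ∘ Ψ) t = torusMap Φ (torusMap Ψ t) := by
  obtain ⟨x, rfl⟩ := proj_surjective t
  rw [(h.comp h').torusMap_proj, h'.torusMap_proj, h.torusMap_proj, h'.realMap_comp]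

lemma continuous_torusMap (h : IsEntireLift Φ) : Continuous (torusMap Φ) := by
  rw [isOpenQuotientMap_proj.isQuotientMap.continuous_iff]
  have : torusMap Φ ∘ proj = proj ∘ realMap Φ := funext h.torusMap_proj
  rw [this]
  exact isOpenQuotientMap_proj.continuous.comp (continuous_realMap h.differentiable.continuous)

end IsEntireLift

lemma isEntireLift_id : IsEntireLift id where
  differentiable := differentiable_id
  equivariant z m n := rfl
  real x y := by simp

lemma torusMap_id (t : Torus) : torusMap id t = t := by
  obtain ⟨x, rfl⟩ := proj_surjective t
  rw [isEntireLift_id.torusMap_proj]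
  simp [realMap]

/-- The displacement of a lift is periodic. -/
lemma IsEntireLift.periodic_displacement {Φ : ℂ × ℂ → ℂ × ℂ} (h : IsEntireLift Φ) (z : ℂ × ℂ)
    (m n : ℤ) : Φ (z.1 + m, z.2 + n) - (z.1 + m, z.2 + n) = Φ z - z := by
  rw [h.equivariant]
  ext <;> simp

/-- A compact fundamental domain for the action of `ℤ²` on the tube. -/
def box (ρ : ℝ) : Set (ℂ × ℂ) :=
  (Set.Icc 0 1 ×ℂ Set.Icc (-ρ) ρ) ×ˢ (Set.Icc 0 1 ×ℂ Set.Icc (-ρ) ρ)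

lemma isCompact_box (ρ : ℝ) : IsCompact (box ρ) :=
  (isCompact_Icc.reProdIm isCompact_Icc).prod (isCompact_Icc.reProdIm isCompact_Icc)

lemma exists_box_add_int {ρ : ℝ} {z : ℂ × ℂ} (hz : z ∈ tube ρ) :
    ∃ w ∈ box ρ, ∃ m n : ℤ, z = (w.1 + m, w.2 + n) := by
  refine ⟨(z.1 - ⌊z.1.re⌋, z.2 - ⌊z.2.re⌋), ?_, ⌊z.1.re⌋, ⌊z.2.re⌋, by simp⟩
  obtain ⟨h₁, h₂⟩ := hz
  rw [abs_lt] at h₁ h₂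
  refine ⟨?_, ?_⟩ <;> rw [Complex.mem_reProdIm] <;>
    simp only [Complex.sub_re, Complex.intCast_re, Complex.sub_im, Complex.intCast_im, sub_zero,
      Set.mem_Icc]
  · exact ⟨⟨Int.fract_nonneg _, (Int.fract_lt_one _).le⟩, h₁.1.le, h₁.2.le⟩
  · exact ⟨⟨Int.fract_nonneg _, (Int.fract_lt_one _).le⟩, h₂.1.le, h₂.2.le⟩

/-- Since the norm is an infimum over extensions, one extension bounds it and uniqueness plays no
role. -/
lemma normRho_le {ρ C : ℝ} {f : ℝ × ℝ → ℝ} {g : ℂ × ℂ → ℂ} (hg : Differentiable ℂ g)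
    (hgf : Extends g f) (hC : ∀ z ∈ tube ρ, ‖g z‖ ≤ C) : normRho ρ f ≤ ENNReal.ofReal C := by
  refine (iInf₂_le g ⟨hg.differentiableOn, hgf⟩).trans (iSup₂_le fun z hz => ?_)
  rw [← ofReal_norm]
  exact ENNReal.ofReal_le_ofReal (hC z hz)

lemma analyticOnNhd_of_extends {f : ℝ × ℝ → ℝ} {g : ℂ × ℂ → ℂ} (hg : Differentiable ℂ g)
    (hgf : Extends g f) : AnalyticOnNhd ℝ f Set.univ := by
  intro x _
  have e : f = fun x => Complex.reCLM (g (Complex.ofRealCLM x.1, Complex.ofRealCLM x.2)) := by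
    funext x
    simpa using (congrArg Complex.re (hgf x)).symm
  rw [e]
  refine (Complex.reCLM.analyticAt _).fun_comp ?_
  refine AnalyticAt.fun_comp (g := g) (f := fun x : ℝ × ℝ => (Complex.ofRealCLM x.1, Complex.ofRealCLM x.2))
    ((hg.analyticOnNhd_prod _ (Set.mem_univ _)).restrictScalars) ?_
  exact ((Complex.ofRealCLM.analyticAt _).fun_comp analyticAt_fst).prod
    ((Complex.ofRealCLM.analyticAt _).fun_comp analyticAt_snd)

namespace IsEntireLift

variable {Φ Ψ : ℂ × ℂ → ℂ × ℂ}

lemma extends₁ (h : IsEntireLift Φ) :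
    Extends (fun z => (Φ z).1 - z.1) (fun x => (realMap Φ x).1 - x.1) := fun x => by
  have := congrArg Prod.fst (h.coe_realMap x)
  simp only at this ⊢
  rw [← this]; simp

lemma extends₂ (h : IsEntireLift Φ) :
    Extends (fun z => (Φ z).2 - z.2) (fun x => (realMap Φ x).2 - x.2) := fun x => by
  have := congrArg Prod.snd (h.coe_realMap x)
  simp only at this ⊢
  rw [← this]; simp

lemma differentiable₁ (h : IsEntireLift Φ) : Differentiable ℂ (fun z => (Φ z).1 - z.1) :=
  h.differentiable.fst.sub differentiable_fst

lemma differentiable₂ (h : IsEntireLift Φ) : Differentiable ℂ (fun z => (Φ z).2 - z.2) :=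
  h.differentiable.snd.sub differentiable_snd

lemma isDisplacement (h : IsEntireLift Φ) : IsDisplacement (torusMap Φ)
    (fun x => (realMap Φ x).1 - x.1) (fun x => (realMap Φ x).2 - x.2) where
  analytic₁ := analyticOnNhd_of_extends h.differentiable₁ h.extends₁
  analytic₂ := analyticOnNhd_of_extends h.differentiable₂ h.extends₂
  periodic₁ x m n := by beta_reduce; rw [h.realMap_add]; simp
  periodic₂ x m n := by beta_reduce; rw [h.realMap_add]; simp
  lift x := by rw [h.torusMap_proj]; simp

lemma exists_bound (h : IsEntireLift Φ) (ρ : ℝ) : ∃ C, ∀ z ∈ tube ρ, ‖Φ z - z‖ ≤ C := by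
  obtain ⟨C, hC⟩ := (isCompact_box ρ).exists_bound_of_continuousOn
    (f := fun z => Φ z - z) (h.differentiable.continuous.sub continuous_id).continuousOn
  refine ⟨C, fun z hz => ?_⟩
  obtain ⟨w, hw, m, n, rfl⟩ := exists_box_add_int hz
  rw [h.periodic_displacement]
  exact hC w hw

lemma mem_analyticSpace (h : IsEntireLift Φ) (ρ : ℝ) :
    (fun x => (realMap Φ x).1 - x.1) ∈ analyticSpace ρ ∧
      (fun x => (realMap Φ x).2 - x.2) ∈ analyticSpace ρ := by
  obtain ⟨C, hC⟩ := h.exists_bound ρ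
  refine ⟨⟨h.isDisplacement.periodic₁, h.isDisplacement.analytic₁, ?_⟩,
    ⟨h.isDisplacement.periodic₂, h.isDisplacement.analytic₂, ?_⟩⟩
  · exact (normRho_le h.differentiable₁ h.extends₁ fun z hz =>
      (norm_fst_le (Φ z - z)).trans (hC z hz)).trans_lt ENNReal.ofReal_lt_top
  · exact (normRho_le h.differentiable₂ h.extends₂ fun z hz =>
      (norm_snd_le (Φ z - z)).trans (hC z hz)).trans_lt ENNReal.ofReal_lt_top

lemma isRealAnalyticMap (h : IsEntireLift Φ) : IsRealAnalyticMap (torusMap Φ) := by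
  refine ⟨realMap Φ, ?_, fun x => (h.torusMap_proj x).symm⟩
  have e : realMap Φ = fun x => (((realMap Φ x).1 - x.1) + x.1, ((realMap Φ x).2 - x.2) + x.2) := by
    funext x
    simp
  rw [e]
  intro x hx
  exact ((h.isDisplacement.analytic₁ x hx).fun_add analyticAt_fst).prod
    ((h.isDisplacement.analytic₂ x hx).fun_add analyticAt_snd)

lemma distRho_le (h : IsEntireLift Φ) (h' : IsEntireLift Ψ) {F G : Torus ≃ Torus}
    (hF : ⇑F = torusMap Φ) (hG : ⇑G = torusMap Ψ) {ρ ε : ℝ}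
    (hε : ∀ z ∈ tube ρ, ‖Φ z - Ψ z‖ ≤ ε) : distRho ρ F G ≤ ENNReal.ofReal ε := by
  have hd := And.intro h.isDisplacement h'.isDisplacement
  rw [← hF, ← hG] at hd
  unfold distRho
  refine iInf_le_of_le _ <| iInf_le_of_le _ <| iInf_le_of_le _ <| iInf_le_of_le _ <|
    iInf_le_of_le hd ?_
  -- The integer shift `0` suffices, as the chosen lifts themselves are close.
  refine max_le ((iInf_le _ 0).trans ?_) ((iInf_le _ 0).trans ?_)
  · refine normRho_le (g := fun z => ((Φ z).1 - z.1) - ((Ψ z).1 - z.1))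
      (h.differentiable₁.sub h'.differentiable₁) (fun x => ?_) fun z hz => ?_
    · have := h.extends₁ x
      have := h'.extends₁ x
      simp_all
    · rw [sub_sub_sub_cancel_right]
      exact (norm_fst_le (Φ z - Ψ z)).trans (hε z hz)
  · refine normRho_le (g := fun z => ((Φ z).2 - z.2) - ((Ψ z).2 - z.2))
      (h.differentiable₂.sub h'.differentiable₂) (fun x => ?_) fun z hz => ?_
    · have := h.extends₂ x
      have := h'.extends₂ x
      simp_all
    · rw [sub_sub_sub_cancel_right]
      exact (norm_snd_le (Φ z - Ψ z)).trans (hε z hz)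

/-- Maps of the torus are uniformly close if their lifts are. -/
lemma dist_torusMap_le (h : IsEntireLift Φ) (h' : IsEntireLift Ψ) {ρ ε : ℝ} (hρ : 0 < ρ)
    (hε : ∀ z ∈ tube ρ, ‖Φ z - Ψ z‖ ≤ ε) (t : Torus) : dist (torusMap Φ t) (torusMap Ψ t) ≤ ε := by
  obtain ⟨x, rfl⟩ := proj_surjective t
  rw [h.torusMap_proj, h'.torusMap_proj]
  have hx := hε (x.1, x.2) (by simp [tube, hρ])
  have key : ∀ a b : ℂ, ‖a - b‖ ≤ ε → dist (a.re : UnitAddCircle) (b.re : UnitAddCircle) ≤ ε := by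
    intro a b hab
    rw [dist_eq_norm, ← AddCircle.coe_sub]
    refine (QuotientAddGroup.norm_mk_le_norm).trans (le_trans ?_ hab)
    rw [Real.norm_eq_abs, ← Complex.sub_re]
    exact Complex.abs_re_le_norm _
  exact max_le (key _ _ ((norm_fst_le _).trans hx)) (key _ _ ((norm_snd_le _).trans hx))

end IsEntireLift

/-- Volume-preserving diffeomorphisms of the torus that lift, together with their inverses, to
holomorphic maps of `ℂ²`. -/
structure EntireDiffeo where
  toFun : ℂ × ℂ → ℂ × ℂ
  invFun : ℂ × ℂ → ℂ × ℂ
  left_inv : ∀ z, invFun (toFun z) = z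
  right_inv : ∀ z, toFun (invFun z) = z
  lift : IsEntireLift toFun
  lift_inv : IsEntireLift invFun
  measurePreserving : MeasurePreserving (torusMap toFun) volume volume

namespace EntireDiffeo

/-- The homeomorphism of the torus defined by an entire diffeomorphism. -/
def torus (H : EntireDiffeo) : Torus ≃ₜ Torus where
  toFun := torusMap H.toFun
  invFun := torusMap H.invFun
  left_inv t := by
    rw [← H.lift_inv.torusMap_comp H.lift, show H.invFun ∘ H.toFun = id from funext H.left_inv,
      torusMap_id]
  right_inv t := by
    rw [← H.lift.torusMap_comp H.lift_inv, show H.toFun ∘ H.invFun = id from funext H.right_inv,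
      torusMap_id]
  continuous_toFun := H.lift.continuous_torusMap
  continuous_invFun := H.lift_inv.continuous_torusMap

lemma mp (H : EntireDiffeo) : MeasurePreserving H.torus volume volume := H.measurePreserving

lemma mp_symm (H : EntireDiffeo) : MeasurePreserving H.torus.symm volume volume :=
  MeasurePreserving.symm H.torus.toMeasurableEquiv H.mp

/-- The inverse of an entire diffeomorphism. -/
def symm (H : EntireDiffeo) : EntireDiffeo where
  toFun := H.invFun
  invFun := H.toFun
  left_inv := H.right_inv
  right_inv := H.left_inv
  lift := H.lift_inv
  lift_inv := H.lift
  measurePreserving := H.mp_symm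

lemma torus_symm (H : EntireDiffeo) : H.symm.torus = H.torus.symm := rfl

/-- The composition of entire diffeomorphisms. -/
def comp (H G : EntireDiffeo) : EntireDiffeo where
  toFun := H.toFun ∘ G.toFun
  invFun := G.invFun ∘ H.invFun
  left_inv z := by simp [H.left_inv, G.left_inv]
  right_inv z := by simp [H.right_inv, G.right_inv]
  lift := H.lift.comp G.lift
  lift_inv := G.lift_inv.comp H.lift_inv
  measurePreserving := by
    rw [show torusMap (H.toFun ∘ G.toFun) = torusMap H.toFun ∘ torusMap G.toFun from
      funext (H.lift.torusMap_comp G.lift)]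
    exact H.measurePreserving.comp G.measurePreserving

@[simp] lemma torus_comp_apply (H G : EntireDiffeo) (t : Torus) :
    (H.comp G).torus t = H.torus (G.torus t) := H.lift.torusMap_comp G.lift t

@[simp] lemma torus_comp_symm_apply (H G : EntireDiffeo) (t : Torus) :
    (H.comp G).torus.symm t = G.torus.symm (H.torus.symm t) :=
  G.lift_inv.torusMap_comp H.lift_inv t

/-- The identity. -/
def refl : EntireDiffeo where
  toFun := id
  invFun := id
  left_inv _ := rfl
  right_inv _ := rfl
  lift := isEntireLift_id
  lift_inv := isEntireLift_id
  measurePreserving := by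
    rw [show torusMap id = id from funext torusMap_id]
    exact MeasurePreserving.id _

lemma isAnalyticDiffeo (H : EntireDiffeo) : IsAnalyticDiffeo H.torus.toEquiv :=
  ⟨H.lift.isRealAnalyticMap, H.lift_inv.isRealAnalyticMap⟩

lemma mem_diffRho (H : EntireDiffeo) (ρ : ℝ) : H.torus.toEquiv ∈ DiffRho ρ :=
  ⟨H.isAnalyticDiffeo, H.mp, _, _, H.lift.isDisplacement, (H.lift.mem_analyticSpace ρ).1,
    (H.lift.mem_analyticSpace ρ).2⟩

lemma isEntire (H : EntireDiffeo) : IsEntire H.torus.toEquiv :=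
  ⟨_, _, H.lift.isDisplacement, ⟨_, H.lift.differentiable₁, H.lift.extends₁⟩,
    ⟨_, H.lift.differentiable₂, H.lift.extends₂⟩⟩

end EntireDiffeo

/-! ### Entire functions on the circle and shears -/

/-- A real function on the circle with a periodic entire extension. -/
structure EntireCircleFn where
  toFun : ℂ → ℂ
  circle : C(UnitAddCircle, ℝ)
  differentiable : Differentiable ℂ toFun
  periodic : Function.Periodic toFun 1
  extends_circle : ∀ x : ℝ, toFun x = (circle (x : UnitAddCircle) : ℂ)

namespace EntireCircleFn

lemma add_int (g : EntireCircleFn) (z : ℂ) (n : ℤ) : g.toFun (z + n) = g.toFun z := by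
  simpa using g.periodic.int_mul n z

lemma re_toFun (g : EntireCircleFn) (x : ℝ) : (g.toFun x).re = g.circle (x : UnitAddCircle) := by
  rw [g.extends_circle, Complex.ofReal_re]

/-- Multiplication by a real number. -/
def smul (c : ℝ) (g : EntireCircleFn) : EntireCircleFn where
  toFun z := c * g.toFun z
  circle := c • g.circle
  differentiable := g.differentiable.const_mul _
  periodic z := by simp [g.periodic z]
  extends_circle x := by simp [g.extends_circle]

/-- Composition with multiplication by `q`. -/
def dilate (q : ℕ) (g : EntireCircleFn) : EntireCircleFn where
  toFun z := g.toFun (q * z)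
  circle := ⟨fun t => g.circle (q • t), by fun_prop⟩
  differentiable := g.differentiable.comp (differentiable_id.const_mul _)
  periodic z := by
    have := g.add_int (q * z) q
    simpa [mul_add] using this
  extends_circle x := by
    have := g.extends_circle (q * x)
    rw [ContinuousMap.coe_mk, ← AddCircle.coe_nsmul, nsmul_eq_mul, ← this]
    simp

end EntireCircleFn

/-- The algebra of continuous functions on the circle that have a periodic entire extension. -/
def entireSubalgebra : Subalgebra ℝ C(UnitAddCircle, ℝ) where
  carrier := {p | ∃ g : EntireCircleFn, g.circle = p}
  mul_mem' := by
    rintro _ _ ⟨g, rfl⟩ ⟨g', rfl⟩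
    exact ⟨⟨g.toFun * g'.toFun, g.circle * g'.circle, g.differentiable.mul g'.differentiable,
      g.periodic.mul g'.periodic, fun x => by simp [g.extends_circle, g'.extends_circle]⟩, rfl⟩
  add_mem' := by
    rintro _ _ ⟨g, rfl⟩ ⟨g', rfl⟩
    exact ⟨⟨g.toFun + g'.toFun, g.circle + g'.circle, g.differentiable.add g'.differentiable,
      g.periodic.add g'.periodic, fun x => by simp [g.extends_circle, g'.extends_circle]⟩, rfl⟩
  algebraMap_mem' r :=
    ⟨⟨fun _ => r, algebraMap ℝ _ r, differentiable_const _, fun _ => rfl, fun x => by simp⟩, rfl⟩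

/-- The functions `cos (2πz)` and `sin (2πz)` are entire and together determine a point of the
circle. -/
lemma entireSubalgebra_separatesPoints : entireSubalgebra.SeparatesPoints := by
  have hcp : Function.Periodic (fun x : ℝ => Real.cos (2 * Real.pi * x)) 1 := fun x => by
    simp [mul_add]
  have hsp : Function.Periodic (fun x : ℝ => Real.sin (2 * Real.pi * x)) 1 := fun x => by
    simp [mul_add]
  have hcc : Continuous hcp.lift := continuous_quot_lift _ (by fun_prop)
  have hsc : Continuous hsp.lift := continuous_quot_lift _ (by fun_prop)
  let C : EntireCircleFn := ⟨fun z => Complex.cos (2 * Real.pi * z), ⟨hcp.lift, hcc⟩, by fun_prop,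
    fun z => by simpa [mul_add] using Complex.cos_periodic _, fun x => by simp [Function.Periodic.lift_coe]⟩
  let S : EntireCircleFn := ⟨fun z => Complex.sin (2 * Real.pi * z), ⟨hsp.lift, hsc⟩, by fun_prop,
    fun z => by simpa [mul_add] using Complex.sin_periodic _, fun x => by simp [Function.Periodic.lift_coe]⟩
  intro a b hab
  by_contra hne
  apply hab
  have hC : C.circle a = C.circle b := by
    by_contra h
    exact hne ⟨_, ⟨_, ⟨C, rfl⟩, rfl⟩, h⟩
  have hS : S.circle a = S.circle b := by
    by_contra h
    exact hne ⟨_, ⟨_, ⟨S, rfl⟩, rfl⟩, h⟩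
  clear hab hne
  induction a using QuotientAddGroup.induction_on with | H a => ?_
  induction b using QuotientAddGroup.induction_on with | H b => ?_
  change Real.cos (2 * Real.pi * a) = Real.cos (2 * Real.pi * b) at hC
  change Real.sin (2 * Real.pi * a) = Real.sin (2 * Real.pi * b) at hS
  have h := Real.Angle.cos_sin_inj hC hS
  rw [Real.Angle.angle_eq_iff_two_pi_dvd_sub] at h
  obtain ⟨k, hk⟩ := h
  have : a = b + k := by
    have hpi : (2 * Real.pi) ≠ 0 := by positivity
    rw [← mul_sub] at hk
    linarith [mul_left_cancel₀ hpi hk]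
  rw [this]
  change ((b + k : ℝ) : UnitAddCircle) = b
  simp

/-- This is Stone–Weierstrass. The approximation is controlled on the real circle only; growth of
the extension in the tubes is harmless, because the next rotation number is chosen afterwards. -/
lemma exists_entireCircleFn_near (p : C(UnitAddCircle, ℝ)) {ε : ℝ} (hε : 0 < ε) :
    ∃ g : EntireCircleFn, ∀ t, |g.circle t - p t| < ε := by
  obtain ⟨⟨_, g, rfl⟩, hg⟩ := ContinuousMap.exists_mem_subalgebra_near_continuousMap_of_separatesPoints
    entireSubalgebra entireSubalgebra_separatesPoints p ε hε
  exact ⟨g, fun t => (ContinuousMap.norm_coe_le_norm (g.circle - p) t).trans_lt hg⟩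

/-- The identity of the circle is approximated in measure by bounded real functions that have a
periodic entire extension. -/
lemma exists_sawtooth {η : ℝ} (hη : 0 < η) :
    ∃ g : EntireCircleFn, (∀ t, |g.circle t| ≤ 2) ∧
      volume {t : UnitAddCircle | η < dist (g.circle t : UnitAddCircle) t} ≤ ENNReal.ofReal η := by
  have hη' : 0 < min η 1 := lt_min hη one_pos
  -- The identity on `[0, 1 - η]`, brought back continuously to `0` at `1`. It has values in `[0,
  -- 1]`, and the approximation error of at most `1` yields the bound `2`.
  let f : ℝ → ℝ := fun x => min x (η⁻¹ * (1 - x))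
  have hf : Continuous f := by fun_prop
  have hf01 : f 0 = f (0 + 1) := by simp [f, hη.le]
  let p : C(UnitAddCircle, ℝ) :=
    ⟨AddCircle.liftIco 1 0 f, AddCircle.liftIco_continuous hf01 hf.continuousOn⟩
  have hp : ∀ x ∈ Set.Ico (0 : ℝ) 1, p (x : UnitAddCircle) = f x := fun x hx =>
    AddCircle.liftIco_coe_apply (f := f) (𝕜 := ℝ) (a := 0) (p := 1) (by rwa [zero_add])
  have hrep : ∀ t : UnitAddCircle, ∃ x ∈ Set.Ico (0 : ℝ) 1, (x : UnitAddCircle) = t := by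
    intro t
    induction t using QuotientAddGroup.induction_on with | H y => ?_
    refine ⟨Int.fract y, ⟨Int.fract_nonneg _, Int.fract_lt_one _⟩, ?_⟩
    rw [Int.fract, AddCircle.coe_sub, coe_intCast, sub_zero]
  obtain ⟨g, hg⟩ := exists_entireCircleFn_near p hη'
  refine ⟨g, fun t => ?_, ?_⟩
  · obtain ⟨x, hx, rfl⟩ := hrep t
    have h1 := hg x
    rw [hp x hx] at h1
    have h2 : |f x| ≤ 1 := by
      have : 0 ≤ η⁻¹ * (1 - x) := mul_nonneg (by positivity) (by linarith [hx.2])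
      rw [abs_le]
      exact ⟨by linarith [le_min hx.1 this], (min_le_left _ _).trans hx.2.le⟩
    have h3 := abs_add_le (g.circle x - f x) (f x)
    rw [sub_add_cancel] at h3
    linarith [min_le_right η 1]
  · have hm := (UnitAddCircle.measurePreserving_mk 0).measure_preimage
      (s := {t : UnitAddCircle | η < dist (g.circle t : UnitAddCircle) t}) (by
        refine (measurableSet_lt measurable_const (Continuous.measurable ?_)).nullMeasurableSet
        exact ((AddCircle.continuous_mk' 1).comp g.circle.continuous).dist continuous_id)
    rw [← hm, Measure.restrict_apply' measurableSet_Ioc]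
    have hsub : ((fun x : ℝ => (x : UnitAddCircle)) ⁻¹'
        {t : UnitAddCircle | η < dist (g.circle t : UnitAddCircle) t} ∩ Set.Ioc (0 : ℝ) (0 + 1))
        ⊆ Set.Icc (1 - η) 1 := by
      rintro x ⟨hx, hx0, hx1⟩
      rw [zero_add] at hx1
      refine ⟨?_, hx1⟩
      by_contra! hlt
      have hfx : f x = x := by
        refine min_eq_left ?_
        have : η⁻¹ * η ≤ η⁻¹ * (1 - x) := by gcongr; linarith
        rw [inv_mul_cancel₀ hη.ne'] at this
        linarith
      have h1 := hg x
      rw [hp x ⟨hx0.le, by linarith⟩, hfx] at h1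
      have h2 : dist ((g.circle x : ℝ) : UnitAddCircle) x ≤ |g.circle x - x| := by
        rw [dist_eq_norm, ← AddCircle.coe_sub]
        exact QuotientAddGroup.norm_mk_le_norm
      have : η < dist ((g.circle x : ℝ) : UnitAddCircle) x := hx
      linarith [min_le_left η 1]
    refine (measure_mono hsub).trans ?_
    simp

lemma measurePreserving_prodMk_add (p : C(UnitAddCircle, ℝ)) :
    MeasurePreserving (fun t : Torus => ((t.1, t.2 + (p t.1 : UnitAddCircle)) : Torus))
      volume volume := by
  have hc : Continuous fun t : UnitAddCircle => ((p t : ℝ) : UnitAddCircle) :=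
    (AddCircle.continuous_mk' 1).comp p.continuous
  refine MeasurePreserving.skew_product (g := fun a b => b + (p a : UnitAddCircle))
    (MeasurePreserving.id _) ?_ (ae_of_all _ fun a => map_add_right_eq_self _ _)
  exact (continuous_snd.add (hc.comp continuous_fst)).measurable

lemma measurePreserving_add_prodMk (p : C(UnitAddCircle, ℝ)) :
    MeasurePreserving (fun t : Torus => ((t.1 + (p t.2 : UnitAddCircle), t.2) : Torus))
      volume volume :=
  (Measure.measurePreserving_swap.comp (measurePreserving_prodMk_add p)).comp
    Measure.measurePreserving_swap

namespace EntireDiffeo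

lemma isEntireLift_shearX (g : EntireCircleFn) :
    IsEntireLift fun z => (z.1 + g.toFun z.2, z.2) where
  differentiable :=
    (differentiable_fst.add (g.differentiable.comp differentiable_snd)).prodMk differentiable_snd
  equivariant z m n := by simp only [g.add_int]; ext <;> simp; ring
  real x y := by simp [g.extends_circle]

lemma isEntireLift_shearY (g : EntireCircleFn) :
    IsEntireLift fun z => (z.1, z.2 + g.toFun z.1) where
  differentiable :=
    differentiable_fst.prodMk (differentiable_snd.add (g.differentiable.comp differentiable_fst))
  equivariant z m n := by simp only [g.add_int]; ext <;> simp; ring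
  real x y := by simp [g.extends_circle]

lemma torusMap_shearX (g : EntireCircleFn) (t : Torus) :
    torusMap (fun z => (z.1 + g.toFun z.2, z.2)) t = (t.1 + (g.circle t.2 : UnitAddCircle), t.2) := by
  obtain ⟨x, rfl⟩ := proj_surjective t
  rw [(isEntireLift_shearX g).torusMap_proj]
  simp [realMap, proj, g.re_toFun]

lemma torusMap_shearY (g : EntireCircleFn) (t : Torus) :
    torusMap (fun z => (z.1, z.2 + g.toFun z.1)) t = (t.1, t.2 + (g.circle t.1 : UnitAddCircle)) := by
  obtain ⟨x, rfl⟩ := proj_surjective t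
  rw [(isEntireLift_shearY g).torusMap_proj]
  simp [realMap, proj, g.re_toFun]

/-- The shear `(x, y) ↦ (x + g(y), y)`. -/
def shearX (g : EntireCircleFn) : EntireDiffeo where
  toFun z := (z.1 + g.toFun z.2, z.2)
  invFun z := (z.1 + (g.smul (-1)).toFun z.2, z.2)
  left_inv z := by simp [EntireCircleFn.smul]
  right_inv z := by simp [EntireCircleFn.smul]
  lift := isEntireLift_shearX g
  lift_inv := isEntireLift_shearX _
  measurePreserving := by
    rw [funext (torusMap_shearX g)]
    exact measurePreserving_add_prodMk g.circle

/-- The shear `(x, y) ↦ (x, y + g(x))`. -/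
def shearY (g : EntireCircleFn) : EntireDiffeo where
  toFun z := (z.1, z.2 + g.toFun z.1)
  invFun z := (z.1, z.2 + (g.smul (-1)).toFun z.1)
  left_inv z := by simp [EntireCircleFn.smul]
  right_inv z := by simp [EntireCircleFn.smul]
  lift := isEntireLift_shearY g
  lift_inv := isEntireLift_shearY _
  measurePreserving := by
    rw [funext (torusMap_shearY g)]
    exact measurePreserving_prodMk_add g.circle

lemma shearX_torus (g : EntireCircleFn) (t : Torus) :
    (shearX g).torus t = (t.1 + (g.circle t.2 : UnitAddCircle), t.2) := torusMap_shearX g t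

lemma shearX_torus_symm (g : EntireCircleFn) (t : Torus) :
    (shearX g).torus.symm t = (t.1 - (g.circle t.2 : UnitAddCircle), t.2) := by
  refine (torusMap_shearX _ t).trans ?_
  simp [EntireCircleFn.smul, sub_eq_add_neg]

lemma shearY_torus (g : EntireCircleFn) (t : Torus) :
    (shearY g).torus t = (t.1, t.2 + (g.circle t.1 : UnitAddCircle)) := torusMap_shearY g t

lemma shearY_torus_symm (g : EntireCircleFn) (t : Torus) :
    (shearY g).torus.symm t = (t.1, t.2 - (g.circle t.1 : UnitAddCircle)) := by
  refine (torusMap_shearY _ t).trans ?_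
  simp [EntireCircleFn.smul, sub_eq_add_neg]

/-- The translation by `a` in the first variable. -/
def translation (a : ℝ) : EntireDiffeo :=
  shearX ⟨fun _ => a, ContinuousMap.const _ a, differentiable_const _, fun _ => rfl, fun _ => rfl⟩

lemma translation_torus (a : ℝ) (t : Torus) : (translation a).torus t = flow a t :=
  shearX_torus _ _

/-- The conjugate `H⁻¹ ∘ φ^a ∘ H` of a translation. -/
def conj (H : EntireDiffeo) (a : ℝ) : EntireDiffeo := H.symm.comp ((translation a).comp H)

lemma conj_toFun (H : EntireDiffeo) (a : ℝ) (z : ℂ × ℂ) :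
    (H.conj a).toFun z = H.invFun ((H.toFun z).1 + a, (H.toFun z).2) := rfl

/-- The inverses are conjugates of translations too, so one closeness estimate serves the maps and
their inverses. -/
lemma conj_invFun (H : EntireDiffeo) (a : ℝ) : (H.conj a).invFun = (H.conj (-a)).toFun := by
  funext z
  change H.invFun ((H.toFun z).1 + ((-1 : ℝ) : ℂ) * a, (H.toFun z).2) = _
  rw [conj_toFun]
  push_cast
  ring_nf

lemma conj_torus (H : EntireDiffeo) (a : ℝ) (t : Torus) :
    (H.conj a).torus t = H.torus.symm (flow a (H.torus t)) := by
  rw [conj, torus_comp_apply, torus_comp_apply, translation_torus, torus_symm]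

lemma fst_torus_conj (H : EntireDiffeo) (a : ℝ) (t : Torus) :
    (H.torus ((H.conj a).torus t)).1 = (H.torus t).1 + (a : UnitAddCircle) := by
  rw [conj_torus, Homeomorph.apply_symm_apply, flow]

/-- `h` commutes with the translation by `a` in the first variable. -/
def CommutesWith (h : EntireDiffeo) (a : ℝ) : Prop :=
  ∀ z : ℂ × ℂ, h.toFun (z.1 + a, z.2) = ((h.toFun z).1 + a, (h.toFun z).2)

/-- The mechanism of the construction: `h` slides past the translation and cancels against its
inverse. However wild `h` is, passing to `h ∘ H` does not change the current map. -/
lemma conj_comp_of_commutesWith {h : EntireDiffeo} {a : ℝ} (hc : h.CommutesWith a)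
    (H : EntireDiffeo) : ((h.comp H).conj a).toFun = (H.conj a).toFun := by
  funext z
  rw [conj_toFun, conj_toFun]
  change H.invFun (h.invFun ((h.toFun (H.toFun z)).1 + a, (h.toFun (H.toFun z)).2)) = _
  rw [← hc, h.left_inv]

lemma CommutesWith.neg {h : EntireDiffeo} {a : ℝ} (hc : h.CommutesWith a) :
    h.CommutesWith (-a) := by
  intro z
  have := hc (z.1 - a, z.2)
  simp only [sub_add_cancel] at this
  simp only [Complex.ofReal_neg, ← sub_eq_add_neg]
  rw [show h.toFun z = h.toFun (z.1, z.2) from rfl, this]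
  simp

end EntireDiffeo

/-! ### Equidistribution of horizontal circles -/

instance : IsProbabilityMeasure (volume : Measure UnitAddCircle) :=
  ⟨UnitAddCircle.measure_univ⟩

lemma abs_integral_sub_le {X : Type*} [MeasurableSpace X] (μ : Measure X) [IsProbabilityMeasure μ]
    {f g : X → ℝ} (hf : Integrable f μ) (hg : Integrable g μ) {B : Set X} (hB : MeasurableSet B)
    {a b : ℝ} (ha0 : 0 ≤ a) (ha : ∀ᵐ x ∂μ, x ∉ B → |f x - g x| ≤ a) (hb : ∀ x, |f x - g x| ≤ b) :
    |(∫ x, f x ∂μ) - ∫ x, g x ∂μ| ≤ a + b * μ.real B := by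
  rw [← integral_sub hf hg]
  have hi : Integrable (fun x => a + B.indicator (fun _ => b) x) μ :=
    (integrable_const a).add ((integrable_const b).indicator hB)
  calc |∫ x, f x - g x ∂μ| ≤ ∫ x, a + B.indicator (fun _ => b) x ∂μ := by
        rw [← Real.norm_eq_abs]
        refine norm_integral_le_of_norm_le hi ?_
        filter_upwards [ha] with x hax
        by_cases hx : x ∈ B
        · simpa [hx] using (hb x).trans (le_add_of_nonneg_left ha0)
        · simpa [hx] using hax hx
    _ = a + b * μ.real B := by
        rw [integral_add (integrable_const a) ((integrable_const b).indicator hB),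
          integral_indicator_const _ hB]
        simp [mul_comm]

lemma _root_.Continuous.integrable_of_compactSpace {X : Type*} [TopologicalSpace X] [CompactSpace X]
    [MeasurableSpace X] [BorelSpace X] (μ : Measure X) [IsFiniteMeasure μ] {f : X → ℝ}
    (hf : Continuous f) : Integrable f μ :=
  hf.integrable_of_hasCompactSupport (HasCompactSupport.of_compactSpace f)

lemma _root_.MeasureTheory.MeasurePreserving.integral_comp_of_continuous {X Y : Type*}
    [MeasurableSpace X] [TopologicalSpace Y] [MeasurableSpace Y] [BorelSpace Y]
    {μ : Measure X} {ν : Measure Y} {T : X → Y} (hT : MeasurePreserving T μ ν) {f : Y → ℝ}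
    (hf : Continuous f) : ∫ x, f (T x) ∂μ = ∫ y, f y ∂ν := by
  rw [← hT.map_eq, integral_map hT.aemeasurable]
  exact hf.measurable.aestronglyMeasurable

/-- Lebesgue measure on the unit interval. -/
abbrev unitMeasure : Measure ℝ := volume.restrict (Set.Ioc (0 : ℝ) (0 + 1))

instance : IsProbabilityMeasure unitMeasure := ⟨by simp⟩

lemma nsmul_add_coe_div {q : ℕ} (hq : 0 < q) (t : UnitAddCircle) (s : ℝ) :
    q • (t + ((s / q : ℝ) : UnitAddCircle)) = q • t + (s : UnitAddCircle) := by
  rw [nsmul_add, ← AddCircle.coe_nsmul, nsmul_eq_mul]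
  congr 2
  field_simp

lemma dist_add_coe_le (t : UnitAddCircle) (s : ℝ) : dist (t + (s : UnitAddCircle)) t ≤ |s| := by
  rw [dist_eq_norm, add_sub_cancel_left]
  exact QuotientAddGroup.norm_mk_le_norm

/-- The closed curve `t ↦ (t, q t)` is equidistributed up to the oscillation of the test function in
the first variable at scale `1 / q`. -/
lemma abs_integral_curve_sub_le {q : ℕ} (hq : 0 < q) {F : Torus → ℝ} (hF : Continuous F) {ε : ℝ}
    (hF' : ∀ t t' u : UnitAddCircle, dist t t' ≤ 1 / q → |F (t, u) - F (t', u)| ≤ ε) :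
    |(∫ t, F (t, q • t)) - ∫ x, F x| ≤ ε := by
  have hc : Continuous fun s : ℝ => ((s / q : ℝ) : UnitAddCircle) :=
    (AddCircle.continuous_mk' 1).comp (by fun_prop)
  -- Averaging over a shift of `t` by `s / q`, with `s` in the unit interval, keeps the curve
  -- integral and turns the curve into `(t + s / q, q t + s)`. Without the shift in the first
  -- coordinate, `(t, q t + s)` has the Lebesgue distribution; the shift costs at most `ε`.
  have h₁ : MeasurePreserving (fun p : ℝ × UnitAddCircle => p.2 + ((p.1 / q : ℝ) : UnitAddCircle))
      (unitMeasure.prod volume) volume := by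
    have := MeasurePreserving.skew_product (μc := volume) (μd := volume)
      (g := fun (a : ℝ) (b : UnitAddCircle) => b + ((a / q : ℝ) : UnitAddCircle))
      (MeasurePreserving.id unitMeasure)
      (continuous_snd.add (hc.comp continuous_fst)).measurable
      (ae_of_all _ fun a => map_add_right_eq_self _ _)
    exact measurePreserving_snd.comp this
  have h₂ : MeasurePreserving (fun p : ℝ × UnitAddCircle =>
      ((p.2, q • p.2 + (p.1 : UnitAddCircle)) : Torus)) (unitMeasure.prod volume) volume := by
    have := MeasurePreserving.skew_product (μc := unitMeasure) (μd := (volume : Measure UnitAddCircle))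
      (g := fun (t : UnitAddCircle) (s : ℝ) => q • t + (s : UnitAddCircle))
      (MeasurePreserving.id (volume : Measure UnitAddCircle)) ?_
      (ae_of_all _ fun t =>
        ((measurePreserving_add_left _ _).comp (UnitAddCircle.measurePreserving_mk 0)).map_eq)
    · exact this.comp Measure.measurePreserving_swap
    · exact ((continuous_fst.nsmul q).add
        ((AddCircle.continuous_mk' 1).comp continuous_snd)).measurable
  have hF₁ : Continuous fun t : UnitAddCircle => F (t, q • t) := by fun_prop
  rw [← h₁.integral_comp_of_continuous hF₁, ← h₂.integral_comp_of_continuous hF]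
  have hmem : ∀ᵐ p ∂(unitMeasure.prod (volume : Measure UnitAddCircle)),
      p.1 ∈ Set.Ioc (0 : ℝ) (0 + 1) :=
    measurePreserving_fst.quasiMeasurePreserving.ae (ae_restrict_mem measurableSet_Ioc)
  have e := integral_sub (h₁.integrable_comp_of_integrable (hF₁.integrable_of_compactSpace _))
    (h₂.integrable_comp_of_integrable (hF.integrable_of_compactSpace _))
  simp only [Function.comp_apply] at e
  rw [← e, ← Real.norm_eq_abs]
  refine (norm_integral_le_of_norm_le_const (C := ε) ?_).trans (by simp)
  filter_upwards [hmem] with p hp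
  rw [nsmul_add_coe_div hq]
  refine hF' _ _ _ ((dist_add_coe_le _ _).trans ?_)
  rw [abs_of_nonneg (div_nonneg hp.1.le (Nat.cast_nonneg q))]
  have := hp.2
  gcongr
  linarith

/-! ### The building block of the conjugations -/

namespace EntireDiffeo

/-- The area-preserving map `(x, y) ↦ (x + φ(y') / q, y')` with `y' = y - φ(q x)`. -/
def blockMap (q : ℕ) (φ : EntireCircleFn) : EntireDiffeo :=
  (shearX (φ.smul (q : ℝ)⁻¹)).comp (shearY ((φ.dilate q).smul (-1)))

variable {q : ℕ} {φ : EntireCircleFn}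

/-- The function `x ↦ φ(q x)` has period `1 / q`, and the other shear adds a function of the second
variable alone. -/
lemma blockMap_commutesWith (hq : 0 < q) (p : ℤ) : (blockMap q φ).CommutesWith (p / q) := by
  intro z
  have hq' : (q : ℂ) ≠ 0 := by exact_mod_cast hq.ne'
  have h : φ.toFun (q * (z.1 + p / q)) = φ.toFun (q * z.1) := by
    rw [← φ.add_int (q * z.1) p]
    congr 1
    field_simp
  simp only [blockMap, comp, shearX, shearY, EntireCircleFn.smul, EntireCircleFn.dilate,
    Function.comp_apply, Complex.ofReal_div, Complex.ofReal_intCast, Complex.ofReal_natCast, h]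
  ext <;> simp
  ring

/-- The second coordinate of `blockMap`. -/
def blockSnd (q : ℕ) (φ : EntireCircleFn) (t : Torus) : UnitAddCircle :=
  t.2 - (φ.circle (q • t.1) : UnitAddCircle)

lemma blockMap_torus (t : Torus) : (blockMap q φ).torus t =
    (t.1 + (((q : ℝ)⁻¹ * φ.circle (blockSnd q φ t) : ℝ) : UnitAddCircle), blockSnd q φ t) := by
  rw [blockMap, torus_comp_apply, shearX_torus, shearY_torus]
  simp [EntireCircleFn.smul, EntireCircleFn.dilate, blockSnd, sub_eq_add_neg]

/-- The preimage of the circle at height `c` is the graph of `t ↦ c + φ(q t)`, which is nearly the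
line of slope `q` because `φ` is nearly the identity. -/
lemma blockMap_torus_symm (t c : UnitAddCircle) : (blockMap q φ).torus.symm
    (t + (((q : ℝ)⁻¹ * φ.circle c : ℝ) : UnitAddCircle), c) =
      (t, c + (φ.circle (q • t) : UnitAddCircle)) := by
  rw [blockMap, torus_comp_symm_apply, shearX_torus_symm, shearY_torus_symm]
  simp [EntireCircleFn.smul, EntireCircleFn.dilate]

lemma dist_fst_blockMap_le (hφ : ∀ t, |φ.circle t| ≤ 2) (t : Torus) :
    dist ((blockMap q φ).torus t).1 t.1 ≤ 2 / q := by
  rw [blockMap_torus]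
  refine (dist_add_coe_le _ _).trans ?_
  rw [abs_mul, abs_of_nonneg (by positivity : 0 ≤ (q : ℝ)⁻¹), div_eq_inv_mul]
  gcongr
  exact hφ _

lemma continuous_coe_circle (φ : EntireCircleFn) :
    Continuous fun t : UnitAddCircle => ((φ.circle t : ℝ) : UnitAddCircle) :=
  (AddCircle.continuous_mk' 1).comp φ.circle.continuous

/-- With `y' = y - φ(q x)` one has `q x' - y = (φ(y') - y') - (φ(q x) - q x)`. Both `y'` and `q x`
are distributed by Lebesgue measure, so each error exceeds `η` on a set of measure at most `η`. -/
lemma volume_blockMap_le (hq : 2 ≤ q) {η : ℝ}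
    (hφ : volume {t : UnitAddCircle | η < dist (φ.circle t : UnitAddCircle) t} ≤ ENNReal.ofReal η) :
    volume {t : Torus | 2 * η < dist (q • ((blockMap q φ).torus t).1) t.2} ≤
      2 * ENNReal.ofReal η := by
  set B : Set UnitAddCircle := {t | η < dist (φ.circle t : UnitAddCircle) t} with hB
  have hBm : MeasurableSet B :=
    measurableSet_lt measurable_const ((continuous_coe_circle φ).dist continuous_id).measurable
  have h₁ : MeasurePreserving (fun t : Torus => q • t.1) volume volume :=
    (AddCircle.ergodic_nsmul hq).toMeasurePreserving.comp measurePreserving_fst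
  have h₂ : MeasurePreserving (fun t : Torus => blockSnd q φ t) volume volume := by
    have := measurePreserving_snd.comp (blockMap q φ).mp
    simpa [Function.comp_def, blockMap_torus] using this
  have hsub : {t : Torus | 2 * η < dist (q • ((blockMap q φ).torus t).1) t.2} ⊆
      (fun t : Torus => q • t.1) ⁻¹' B ∪ (fun t : Torus => blockSnd q φ t) ⁻¹' B := by
    intro t ht
    by_contra hn
    simp only [Set.mem_union, Set.mem_preimage, not_or, hB, Set.mem_ofPred_eq, not_lt] at hn
    refine absurd (show 2 * η < dist (q • ((blockMap q φ).torus t).1) t.2 from ht) (not_lt.2 ?_)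
    rw [blockMap_torus]
    have e : q • (t.1 + (((q : ℝ)⁻¹ * φ.circle (blockSnd q φ t) : ℝ) : UnitAddCircle)) - t.2 =
        ((φ.circle (blockSnd q φ t) : UnitAddCircle) - blockSnd q φ t) -
          ((φ.circle (q • t.1) : UnitAddCircle) - q • t.1) := by
      rw [← div_eq_inv_mul, nsmul_add_coe_div (by omega)]
      simp only [blockSnd]
      abel
    rw [dist_eq_norm] at hn ⊢
    rw [dist_eq_norm] at hn
    simp only
    rw [e, two_mul]
    exact (norm_sub_le _ _).trans (add_le_add hn.2 hn.1)
  calc _ ≤ _ := measure_mono hsub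
    _ ≤ _ := measure_union_le _ _
    _ = volume B + volume B := by
      rw [h₁.measure_preimage hBm.nullMeasurableSet, h₂.measure_preimage hBm.nullMeasurableSet]
    _ ≤ 2 * ENNReal.ofReal η := by
      rw [two_mul]
      gcongr

/-- Equidistribution of `(t, q t)`, tested on `F(x, c + φ(y))`, costs one `ε`. Replacing `φ(y)` by
`y` costs another `ε` off the bad set of `φ` and `2 M η` on it. Translation by `c` then costs
nothing. -/
lemma abs_integral_blockMap_sub_le (hq : 0 < q) {η : ℝ} (hη : 0 ≤ η)
    (hφ : volume {t : UnitAddCircle | η < dist (φ.circle t : UnitAddCircle) t} ≤ ENNReal.ofReal η)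
    {F : Torus → ℝ} (hF : Continuous F) {M ε δ : ℝ} (hM : ∀ x, |F x| ≤ M) (hε : 0 ≤ ε)
    (hF' : ∀ x y, dist x y ≤ δ → |F x - F y| ≤ ε) (hηδ : η ≤ δ) (hqδ : 1 / q ≤ δ)
    (c : UnitAddCircle) :
    |(∫ t, F ((blockMap q φ).torus.symm (t, c))) - ∫ x, F x| ≤ 2 * ε + 2 * M * η := by
  have hδ : 0 ≤ δ := hη.trans hηδ
  have hφc := continuous_coe_circle φ
  have h₁ : ∫ t, F ((blockMap q φ).torus.symm (t, c)) =
      ∫ t : UnitAddCircle, F (t, c + (φ.circle (q • t) : UnitAddCircle)) := by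
    -- Rotating the circle by `φ(c) / q` undoes the horizontal shear at height `c`.
    rw [← integral_add_right_eq_self _ (((q : ℝ)⁻¹ * φ.circle c : ℝ) : UnitAddCircle)]
    simp_rw [blockMap_torus_symm]
  have hG : Continuous fun x : Torus => F (x.1, c + (φ.circle x.2 : UnitAddCircle)) := by
    fun_prop
  have h₂ := abs_integral_curve_sub_le hq hG fun t t' u htt =>
    hF' _ _ (by simpa [Prod.dist_eq, hδ] using htt.trans hqδ)
  have hmp : MeasurePreserving (fun x : Torus => ((x.1, c + x.2) : Torus)) volume volume :=
    (MeasurePreserving.id _).prod (measurePreserving_add_left _ _)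
  have hG' : Continuous fun x : Torus => F (x.1, c + x.2) := by fun_prop
  set B : Set Torus := Prod.snd ⁻¹' {t | η < dist (φ.circle t : UnitAddCircle) t} with hB
  have hBm₀ : MeasurableSet {t : UnitAddCircle | η < dist (φ.circle t : UnitAddCircle) t} :=
    measurableSet_lt measurable_const (hφc.dist continuous_id).measurable
  have hBm : MeasurableSet B := measurable_snd hBm₀
  have hBv : volume.real B ≤ η := by
    rw [Measure.real]
    refine ENNReal.toReal_le_of_le_ofReal hη ?_
    exact ((measurePreserving_snd (μ := volume) (ν := volume)).measure_preimage
      hBm₀.nullMeasurableSet).trans_le hφ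
  have h₃ := abs_integral_sub_le volume (hG.integrable_of_compactSpace _)
    (hG'.integrable_of_compactSpace _) hBm hε (b := 2 * M) (ae_of_all _ fun x hx => ?_) fun x => ?_
  · rw [hmp.integral_comp_of_continuous hF] at h₃
    rw [h₁]
    have hM0 : 0 ≤ M := (abs_nonneg _).trans (hM 0)
    have : 2 * M * volume.real B ≤ 2 * M * η := by gcongr
    simp only at h₂
    exact (abs_sub_le _ _ _).trans (by linarith)
  · refine hF' _ _ ?_
    have hx' : dist (φ.circle x.2 : UnitAddCircle) x.2 ≤ η := not_lt.1 hx
    simpa [Prod.dist_eq, hδ] using hx'.trans hηδ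
  · rw [two_mul]
    exact (abs_sub _ _).trans (add_le_add (hM _) (hM _))

end EntireDiffeo

/-- A dense sequence of continuous test functions on the torus. -/
def testFn : ℕ → C(Torus, ℝ) := TopologicalSpace.denseSeq C(Torus, ℝ)

lemma exists_modulus {X Y : Type*} [PseudoMetricSpace X] [CompactSpace X] [PseudoMetricSpace Y]
    {f : X → Y} (hf : Continuous f) {ε : ℝ} (hε : 0 < ε) :
    ∃ δ > 0, ∀ x y, dist x y ≤ δ → dist (f x) (f y) ≤ ε := by
  obtain ⟨δ, hδ, h⟩ := Metric.uniformContinuous_iff.1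
    (CompactSpace.uniformContinuous_of_continuous hf) ε hε
  exact ⟨δ / 2, half_pos hδ, fun x y hxy => (h (hxy.trans_lt (half_lt_self hδ))).le⟩

/-- A common modulus of continuity and bound for finitely many functions. -/
lemma exists_modulus_bound {X : Type*} [PseudoMetricSpace X] [CompactSpace X] (f : ℕ → X → ℝ)
    (hf : ∀ j, Continuous (f j)) (n : ℕ) {ε : ℝ} (hε : 0 < ε) :
    ∃ δ > 0, ∃ M ≥ 0, ∀ j ≤ n, (∀ x, |f j x| ≤ M) ∧
      ∀ x y, dist x y ≤ δ → |f j x - f j y| ≤ ε := by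
  let F : X → Fin (n + 1) → ℝ := fun x j => f j x
  have hF : Continuous F := continuous_pi fun j => hf j
  obtain ⟨δ, hδ, h⟩ := exists_modulus hF hε
  obtain ⟨M, hM⟩ := isCompact_univ.exists_bound_of_continuousOn hF.continuousOn
  refine ⟨δ, hδ, max M 0, le_max_right _ _, fun j hj => ⟨fun x => ?_, fun x y hxy => ?_⟩⟩
  · exact ((norm_le_pi_norm (F x) ⟨j, by omega⟩).trans (hM x (Set.mem_univ x))).trans
      (le_max_left _ _)
  · exact (dist_le_pi_dist (F x) (F y) ⟨j, by omega⟩).trans (h x y hxy)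

namespace EntireDiffeo

/-- The curve `s ↦ H⁻¹(s, q s)` on the torus. -/
def curve (H : EntireDiffeo) (q : ℕ) (s : UnitAddCircle) : Torus := H.torus.symm (s, q • s)

lemma continuous_curve (H : EntireDiffeo) (q : ℕ) : Continuous (H.curve q) :=
  H.torus.symm.continuous.comp (continuous_id.prodMk (continuous_id.nsmul q))

/-- The properties of a map `h` that make `h ∘ H` the next conjugation. -/
structure IsGoodStep (n : ℕ) (κ : ℝ) (H : EntireDiffeo) (q : ℕ) (h : EntireDiffeo) : Prop where
  commutesWith : ∀ p : ℤ, h.CommutesWith (p / q)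
  dist_fst_le : ∀ x, dist (h.torus x).1 x.1 ≤ κ
  volume_curve_le : volume {x | (1 / 2 : ℝ) ^ n < dist (H.curve q (h.torus (H.torus x)).1) x} ≤
    ENNReal.ofReal ((1 / 2 : ℝ) ^ n)
  equidistributed : ∀ j ≤ n, ∀ c,
    |(∫ t, testFn j (H.torus.symm (h.torus.symm (t, c)))) - ∫ x, testFn j x| ≤ (1 / 2 : ℝ) ^ n

/-- The function `φ` is fixed using moduli and bounds for `H⁻¹` and the test functions; only then
must `q` be large. As every large `q` works, it can be chosen together with the other requirements
on a rotation number. -/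
lemma eventually_exists_isGoodStep (n : ℕ) {κ : ℝ} (hκ : 0 < κ) (H : EntireDiffeo) :
    ∀ᶠ q in atTop, ∃ h, IsGoodStep n κ H q h := by
  set ε : ℝ := (1 / 2 : ℝ) ^ n with hεdef
  have hε : 0 < ε := by positivity
  obtain ⟨δ₁, hδ₁, h₁⟩ := exists_modulus H.torus.symm.continuous hε
  obtain ⟨δ₂, hδ₂, M, hM, h₂⟩ := exists_modulus_bound (fun j x => testFn j (H.torus.symm x))
    (fun j => (testFn j).continuous.comp H.torus.symm.continuous) n (by positivity : 0 < ε / 4)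
  set δ := min δ₁ δ₂
  have hδ : 0 < δ := lt_min hδ₁ hδ₂
  -- The second bound gives `2 η ≤ ε` for the exceptional set and `2 M η ≤ ε / 2`, which with `2 *
  -- (ε / 4)` makes `ε` for equidistribution.
  set η := min (δ / 2) (ε / (4 * (M + 1)))
  have hη : 0 < η := lt_min (by positivity) (by positivity)
  have hηδ : 2 * η ≤ δ := by linarith [min_le_left (δ / 2) (ε / (4 * (M + 1)))]
  have hηε : η * (4 * (M + 1)) ≤ ε := by
    rw [← le_div_iff₀ (by positivity)]
    exact min_le_right _ _
  obtain ⟨φ, hφ₁, hφ₂⟩ := exists_sawtooth hη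
  have hlim : Tendsto (fun q : ℕ => (2 : ℝ) / q) atTop (𝓝 0) :=
    tendsto_const_div_atTop_nhds_zero_nat 2
  filter_upwards [eventually_ge_atTop 2, hlim.eventually_le_const hκ,
    hlim.eventually_le_const hδ] with q hq hqκ hqδ
  refine ⟨blockMap q φ, blockMap_commutesWith (by omega),
    fun x => (dist_fst_blockMap_le hφ₁ x).trans hqκ, ?_, fun j hj c => ?_⟩
  · have hmeas : MeasurableSet {t : Torus | 2 * η < dist (q • ((blockMap q φ).torus t).1) t.2} := by
      refine measurableSet_lt measurable_const (Continuous.measurable ?_)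
      exact (((continuous_fst.comp (blockMap q φ).torus.continuous).nsmul q)).dist continuous_snd
    calc _ ≤ volume (H.torus ⁻¹' {t : Torus | 2 * η < dist (q • ((blockMap q φ).torus t).1) t.2}) := by
          refine measure_mono fun x hx => ?_
          by_contra hn
          refine absurd (show ε < dist (H.curve q ((blockMap q φ).torus (H.torus x)).1) x from hx)
            (not_lt.2 ?_)
          have hn' : dist (q • ((blockMap q φ).torus (H.torus x)).1) (H.torus x).2 ≤ 2 * η :=
            not_lt.1 hn
          rw [← H.torus.symm_apply_apply x, Homeomorph.apply_symm_apply]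
          refine h₁ _ _ (max_le ?_ ?_)
          · exact ((dist_fst_blockMap_le hφ₁ _).trans hqδ).trans (min_le_left _ _)
          · exact (hn'.trans hηδ).trans (min_le_left _ _)
      _ = _ := H.mp.measure_preimage hmeas.nullMeasurableSet
      _ ≤ 2 * ENNReal.ofReal η := volume_blockMap_le hq hφ₂
      _ ≤ ENNReal.ofReal ε := by
        rw [← ENNReal.ofReal_ofNat, ← ENNReal.ofReal_mul (by norm_num)]
        refine ENNReal.ofReal_le_ofReal ?_
        nlinarith
  · have := abs_integral_blockMap_sub_le (φ := φ) (by omega : 0 < q) hη.le hφ₂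
      ((testFn j).continuous.comp H.torus.symm.continuous) (h₂ j hj).1 (by positivity)
      (δ := δ) (fun x y hxy => (h₂ j hj).2 x y (hxy.trans (min_le_right _ _))) (by linarith)
      (le_trans (by gcongr; norm_num) hqδ) c
    simp only [Function.comp_apply] at this
    rw [H.mp_symm.integral_comp_of_continuous (testFn j).continuous] at this
    nlinarith

end EntireDiffeo

/-! ### Orbit averages -/

lemma exists_zsmul_eq_div {P : ℤ} {Q : ℕ} (hQ : 0 < Q) (hPQ : IsCoprime P (Q : ℤ)) (j : ℤ) :
    ∃ m : ℤ, m • ((P / Q : ℝ) : UnitAddCircle) = ((j / Q : ℝ) : UnitAddCircle) := by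
  obtain ⟨u, v, huv⟩ := hPQ
  refine ⟨j * u, ?_⟩
  have hQ' : (Q : ℝ) ≠ 0 := by exact_mod_cast hQ.ne'
  have huv' : (u : ℝ) * P + v * Q = 1 := by exact_mod_cast huv
  rw [← AddCircle.coe_zsmul, zsmul_eq_mul]
  have : ((j * u : ℤ) : ℝ) * (P / Q) = j / Q - ((j * v : ℤ) : ℝ) := by
    push_cast
    field_simp
    linear_combination (j : ℝ) * huv'
  rw [this, AddCircle.coe_sub, coe_intCast, sub_zero]

lemma exists_dist_add_div_le {Q : ℕ} (hQ : 0 < Q) (z w : UnitAddCircle) :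
    ∃ j : ℤ, dist (z + ((j / Q : ℝ) : UnitAddCircle)) w ≤ 1 / Q := by
  have hQ' : (0 : ℝ) < Q := by exact_mod_cast hQ
  obtain ⟨x, hx⟩ := QuotientAddGroup.mk_surjective (w - z)
  refine ⟨⌊Q * x⌋, ?_⟩
  have hw : w = z + (x : UnitAddCircle) := by
    rw [show (x : UnitAddCircle) = w - z from hx]
    abel
  rw [hw, dist_add_left, dist_eq_norm, ← AddCircle.coe_sub]
  refine QuotientAddGroup.norm_mk_le_norm.trans ?_
  rw [Real.norm_eq_abs, abs_le, div_sub' hQ'.ne', div_le_div_iff_of_pos_right hQ',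
    neg_le, ← neg_div, div_le_div_iff_of_pos_right hQ']
  constructor <;> linarith [Int.floor_le (Q * x), Int.lt_floor_add_one (Q * x)]

/-- Averages over the orbits of a rational rotation are Riemann sums. -/
lemma abs_average_sub_integral_le {P : ℤ} {Q : ℕ} (hQ : 0 < Q) (hPQ : IsCoprime P (Q : ℤ))
    {ψ : UnitAddCircle → ℝ} (hψ : Continuous ψ) {ε : ℝ}
    (hε : ∀ s t, dist s t ≤ 1 / Q → |ψ s - ψ t| ≤ ε) (z : UnitAddCircle) :
    |(Q : ℝ)⁻¹ * ∑ k ∈ Finset.range Q, ψ (z + k • ((P / Q : ℝ) : UnitAddCircle)) - ∫ t, ψ t| ≤ ε := by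
  set b := ((P / Q : ℝ) : UnitAddCircle) with hb
  have hQ' : (Q : ℝ) ≠ 0 := by exact_mod_cast hQ.ne'
  -- The average over a full period is invariant under rotation by `P / Q`, hence by coprimality
  -- under all multiples of `1 / Q`. It therefore oscillates by at most `ε`, and its mean is the
  -- integral of `ψ`.
  let A : UnitAddCircle → ℝ := fun z => (Q : ℝ)⁻¹ * ∑ k ∈ Finset.range Q, ψ (z + k • b)
  have hQb : Q • b = 0 := by
    rw [hb, ← AddCircle.coe_nsmul, nsmul_eq_mul, mul_div_cancel₀ _ hQ', coe_intCast]
  have hA : Function.Periodic A b := by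
    intro z
    simp only [A]
    congr 1
    have h1 := Finset.sum_range_succ (fun k => ψ (z + k • b)) Q
    rw [Finset.sum_range_succ', hQb, zero_smul] at h1
    simpa [succ_nsmul', add_assoc] using h1
  have hAA : ∀ z w, |A z - A w| ≤ ε := by
    intro z w
    obtain ⟨j, hj⟩ := exists_dist_add_div_le hQ z w
    obtain ⟨m, hm⟩ := exists_zsmul_eq_div hQ hPQ j
    rw [← hm] at hj
    rw [← hA.zsmul m z]
    simp only [A]
    rw [← mul_sub, ← Finset.sum_sub_distrib, abs_mul, abs_of_nonneg (by positivity : 0 ≤ (Q : ℝ)⁻¹)]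
    calc _ ≤ (Q : ℝ)⁻¹ * ∑ k ∈ Finset.range Q, ε := by
          gcongr
          refine (Finset.abs_sum_le_sum_abs _ _).trans (Finset.sum_le_sum fun k _ => hε _ _ ?_)
          rwa [dist_add_right]
      _ = ε := by
          rw [Finset.sum_const, Finset.card_range, nsmul_eq_mul, inv_mul_cancel_left₀ hQ']
  have hint : ∀ k : ℕ, Integrable (fun w => ψ (w + k • b)) :=
    fun k => Continuous.integrable_of_compactSpace _ (by fun_prop)
  have hAint : Integrable A := (integrable_finsetSum _ fun k _ => hint k).const_mul _
  have hAψ : ∫ w, A w = ∫ t, ψ t := by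
    simp only [A]
    rw [integral_const_mul, integral_finsetSum _ fun k _ => hint k]
    simp_rw [integral_add_right_eq_self]
    rw [Finset.sum_const, Finset.card_range, nsmul_eq_mul, inv_mul_cancel_left₀ hQ']
  change |A z - _| ≤ ε
  have e : A z - ∫ t, ψ t = ∫ w, (A z - A w) := by
    rw [integral_sub (integrable_const _) hAint, hAψ]
    simp
  rw [e, ← Real.norm_eq_abs]
  exact (norm_integral_le_of_norm_le_const (ae_of_all _ fun w => hAA z w)).trans (by simp)

/-- The average of a function over an orbit segment. -/
def orbitAverage (G : C(Torus, ℝ)) (N : ℕ) (T : Torus → Torus) (x : Torus) : ℝ :=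
  (N : ℝ)⁻¹ * ∑ k ∈ Finset.range N, G (T^[k] x)

lemma EntireDiffeo.iterate_conj (H : EntireDiffeo) (a : ℝ) (k : ℕ) (x : Torus) :
    (H.conj a).torus^[k] x =
      H.torus.symm ((H.torus x).1 + k • (a : UnitAddCircle), (H.torus x).2) := by
  induction k with
  | zero => simp
  | succ k ih =>
    rw [Function.iterate_succ_apply', ih, conj_torus, Homeomorph.apply_symm_apply, flow, succ_nsmul,
      add_assoc]

lemma EntireDiffeo.abs_orbitAverage_conj_sub_le (H : EntireDiffeo) (G : C(Torus, ℝ)) {P : ℤ} {Q : ℕ}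
    (hQ : 0 < Q) (hPQ : IsCoprime P (Q : ℤ)) {ε : ℝ}
    (hε : ∀ u v, dist u v ≤ 1 / Q → |G (H.torus.symm u) - G (H.torus.symm v)| ≤ ε) (x : Torus) :
    |orbitAverage G Q (H.conj (P / Q)).torus x - ∫ t, G (H.torus.symm (t, (H.torus x).2))| ≤ ε := by
  unfold orbitAverage
  simp_rw [H.iterate_conj]
  refine abs_average_sub_integral_le (ψ := fun t => G (H.torus.symm (t, (H.torus x).2))) hQ hPQ
    ?_ (fun s t hst => hε _ _ ?_) _
  · exact G.continuous.comp (H.torus.symm.continuous.comp (by fun_prop))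
  · simpa [Prod.dist_eq] using hst

/-- The iterates of a continuous map. -/
def iter {X : Type*} [TopologicalSpace X] (T : C(X, X)) : ℕ → C(X, X)
  | 0 => ContinuousMap.id X
  | k + 1 => T.comp (iter T k)

lemma iter_apply {X : Type*} [TopologicalSpace X] (T : C(X, X)) (k : ℕ) (x : X) :
    iter T k x = T^[k] x := by
  induction k with
  | zero => rfl
  | succ k ih => rw [Function.iterate_succ_apply', ← ih]; rfl

lemma continuous_iter {X : Type*} [TopologicalSpace X] [LocallyCompactSpace X] (k : ℕ) :
    Continuous fun T : C(X, X) => iter T k := by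
  induction k with
  | zero => exact continuous_const
  | succ k ih => exact continuous_id.compCM ih

/-- For a fixed length `N`, the average depends continuously on the map in the uniform topology.
This carries the estimates for one stage over to the limit. -/
lemma eventually_orbitAverage_near (G : C(Torus, ℝ)) (N : ℕ) (T₀ : C(Torus, Torus)) {ε : ℝ}
    (hε : 0 < ε) :
    ∀ᶠ T : C(Torus, Torus) in 𝓝 T₀, ∀ x, |orbitAverage G N T x - orbitAverage G N T₀ x| ≤ ε := by
  let A : C(Torus, Torus) → C(Torus, ℝ) := fun T =>
    (N : ℝ)⁻¹ • ∑ k ∈ Finset.range N, G.comp (iter T k)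
  have hA : Continuous A := by
    have h : ∀ k, Continuous fun T : C(Torus, Torus) => G.comp (iter T k) := fun k =>
      G.continuous_postcomp.comp (continuous_iter k)
    fun_prop
  have hval : ∀ T x, A T x = orbitAverage G N T x := by
    intro T x
    simp [A, orbitAverage, iter_apply]
  filter_upwards [hA.continuousAt.eventually (Metric.ball_mem_nhds (A T₀) hε)] with T hT x
  rw [← hval, ← hval]
  exact (ContinuousMap.dist_apply_le_dist x).trans hT.le

lemma eventually_comp_near {X Y : Type*} [TopologicalSpace X] [CompactSpace X] [PseudoMetricSpace Y]
    (K : C(X, Y)) (T₀ : C(X, X)) {ε : ℝ} (hε : 0 < ε) :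
    ∀ᶠ T : C(X, X) in 𝓝 T₀, ∀ x, dist (K (T x)) (K (T₀ x)) ≤ ε := by
  have hc : Continuous fun T : C(X, X) => K.comp T := K.continuous_postcomp
  filter_upwards [hc.continuousAt.eventually (Metric.ball_mem_nhds (K.comp T₀) hε)] with T hT x
  exact (ContinuousMap.dist_apply_le_dist (f := K.comp T) (g := K.comp T₀) x).trans hT.le

/-- Displacements are periodic, so the tube reduces to a compact box, where joint continuity in `(a,
z)` suffices. -/
lemma EntireDiffeo.eventually_conj_near (H : EntireDiffeo) (a₀ ρ : ℝ) {ε : ℝ} (hε : 0 < ε) :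
    ∀ᶠ a in 𝓝 a₀, ∀ z ∈ tube ρ, ‖(H.conj a).toFun z - (H.conj a₀).toFun z‖ ≤ ε := by
  have hc₁ : Continuous H.toFun := H.lift.differentiable.continuous
  have hc₂ : Continuous H.invFun := H.lift_inv.differentiable.continuous
  have hbox : ∀ᶠ a in 𝓝 a₀, ∀ z ∈ box ρ, ‖(H.conj a).toFun z - (H.conj a₀).toFun z‖ ≤ ε := by
    refine (isCompact_box ρ).eventually_forall_of_forall_eventually fun z _ => ?_
    have key : ∀ f : ℝ × (ℂ × ℂ) → ℝ, Continuous f → f (a₀, z) < ε → ∀ᶠ p in 𝓝 (a₀, z), f p ≤ ε :=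
      fun f hf h0 => (hf.continuousAt.eventually_lt_const h0).mono fun p hp => hp.le
    refine key (fun p => ‖(H.conj p.1).toFun p.2 - (H.conj a₀).toFun p.2‖) ?_ (by simpa using hε)
    simp only [conj_toFun]
    fun_prop
  filter_upwards [hbox] with a ha z hz
  obtain ⟨w, hw, m, n, rfl⟩ := exists_box_add_int hz
  rw [(H.conj a).lift.equivariant, (H.conj a₀).lift.equivariant]
  have : (((H.conj a).toFun w).1 + m, ((H.conj a).toFun w).2 + n) -
      (((H.conj a₀).toFun w).1 + (m : ℂ), ((H.conj a₀).toFun w).2 + (n : ℂ)) =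
      (H.conj a).toFun w - (H.conj a₀).toFun w := by ext <;> simp
  rw [this]
  exact ha w hw

/-! ### The inductive construction -/

lemma exists_seq_of_forall_exists {S : Type*} {I : ℕ → S → Prop} {R : ℕ → S → S → Prop}
    (h0 : ∃ s, I 0 s) (hs : ∀ n s, I n s → ∃ s', I (n + 1) s' ∧ R n s s') :
    ∃ u : ℕ → S, (∀ n, I n (u n)) ∧ ∀ n, R n (u n) (u (n + 1)) := by
  obtain ⟨s₀, hs₀⟩ := h0
  choose f hfI hfR using hs
  let v : ∀ n, {s // I n s} := fun n =>
    Nat.rec ⟨s₀, hs₀⟩ (fun n s => ⟨f n s.1 s.2, hfI n s.1 s.2⟩) n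
  exact ⟨fun n => (v n).1, fun n => (v n).2, fun n => hfR n (v n).1 (v n).2⟩

/-- The factor `2` is the geometric series `ε + ε / 2 + ⋯`, which bounds the total motion of all
later maps. -/
lemma exists_pos_le_forall_near {X : Type*} [PseudoMetricSpace X] [CompactSpace X] {T₀ : C(X, X)}
    {p : C(X, X) → Prop} (hp : ∀ᶠ T : C(X, X) in 𝓝 T₀, p T) {b : ℝ} (hb : 0 < b) :
    ∃ ε > 0, ε ≤ b ∧ ∀ T : C(X, X), (∀ x, dist (T x) (T₀ x) ≤ 2 * ε) → p T := by
  obtain ⟨r, hr, h⟩ := Metric.eventually_nhds_iff.1 hp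
  refine ⟨min b (r / 4), lt_min hb (by positivity), min_le_left _ _, fun T hT => h ?_⟩
  have h2 : 2 * min b (r / 4) ≤ r / 2 := by linarith [min_le_right b (r / 4)]
  have h0 : 0 ≤ 2 * min b (r / 4) := by positivity
  exact (((ContinuousMap.dist_le h0).2 hT).trans h2).trans_lt (by linarith)

/-- The data of one stage of the construction: the conjugation `H`, the rotation number `p / q`,
the room `ε` left for the later maps and the room `κ` left for the later factor maps. -/
structure Stage where
  H : EntireDiffeo
  p : ℤ
  q : ℕ
  ε : ℝ
  κ : ℝ

namespace Stage

/-- The rotation number of a stage. -/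
def a (s : Stage) : ℝ := s.p / s.q

/-- The map of a stage. -/
def T (s : Stage) : EntireDiffeo := s.H.conj s.a

/-- The factor map of a stage. -/
def K (s : Stage) (x : Torus) : UnitAddCircle := (s.H.torus x).1

lemma continuous_K (s : Stage) : Continuous s.K := continuous_fst.comp s.H.torus.continuous

lemma measurePreserving_K (s : Stage) : MeasurePreserving s.K volume volume :=
  measurePreserving_fst.comp s.H.mp

/-- The requirements on the `n`-th stage. -/
structure Admissible (n : ℕ) (s : Stage) : Prop where
  two_le_q : 2 ≤ s.q
  p_nonneg : 0 ≤ s.p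
  p_lt_q : s.p < s.q
  ε_pos : 0 < s.ε
  κ_pos : 0 < s.κ
  -- Kept as an invariant because `q` must be large in terms of `H` and `κ`, and is fixed before `h`
  -- is used.
  exists_step : ∃ h, EntireDiffeo.IsGoodStep n s.κ s.H s.q h
  -- This bound makes the limit rotation number Liouville.
  ε_le_q : s.ε ≤ 1 / (4 * (s.q : ℝ) ^ n)
  ε_le : s.ε ≤ (1 / 2 : ℝ) ^ n
  factor : ∀ T : C(Torus, Torus), (∀ x, dist (T x) (s.T.torus x) ≤ 2 * s.ε) →
    ∀ x, dist (s.K (T x)) (s.K x + (s.a : UnitAddCircle)) ≤ (1 / 2 : ℝ) ^ n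

/-- The requirements on the passage from the `n`-th stage to the next one. -/
structure Step (n : ℕ) (s s' : Stage) : Prop where
  a_lt : s.a < s'.a
  a_le : s'.a ≤ s.a + s.ε
  ε_le_half : s'.ε ≤ s.ε / 2
  κ_le_half : s'.κ ≤ s.κ / 2
  toFun_near : ∀ z ∈ tube (n + 1), ‖s'.T.toFun z - s.T.toFun z‖ ≤ s.ε
  invFun_near : ∀ z ∈ tube (n + 1), ‖s'.T.invFun z - s.T.invFun z‖ ≤ s.ε
  K_near : ∀ x, dist (s'.K x) (s.K x) ≤ s.κ
  curve_near : ∀ u v, dist u v ≤ 2 * s'.κ →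
    dist (s.H.curve s.q u) (s.H.curve s.q v) ≤ (1 / 2 : ℝ) ^ n
  volume_curve_le : volume {x | (1 / 2 : ℝ) ^ n < dist (s.H.curve s.q (s'.K x)) x} ≤
    ENNReal.ofReal ((1 / 2 : ℝ) ^ n)
  average : ∃ N > 0, ∀ T : C(Torus, Torus), (∀ x, dist (T x) (s'.T.torus x) ≤ 2 * s'.ε) →
    ∀ j ≤ n, ∀ x, |orbitAverage (testFn j) N T x - ∫ y, testFn j y| ≤ 3 * (1 / 2 : ℝ) ^ n

lemma eventually_factor (H : EntireDiffeo) (a : ℝ) (n : ℕ) :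
    ∀ᶠ T : C(Torus, Torus) in 𝓝 (⟨(H.conj a).torus, (H.conj a).torus.continuous⟩ : C(Torus, Torus)),
      ∀ x, dist (H.torus (T x)).1 ((H.torus x).1 + (a : UnitAddCircle)) ≤ (1 / 2 : ℝ) ^ n := by
  have h := eventually_comp_near
    (⟨fun x => (H.torus x).1, continuous_fst.comp H.torus.continuous⟩ : C(Torus, UnitAddCircle))
    (⟨(H.conj a).torus, (H.conj a).torus.continuous⟩ : C(Torus, Torus))
    (ε := (1 / 2 : ℝ) ^ n) (by positivity)
  filter_upwards [h] with T hT x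
  rw [← H.fst_torus_conj]
  exact hT x

lemma exists_admissible_zero : ∃ s, Admissible 0 s := by
  obtain ⟨q, hq, h2⟩ := ((EntireDiffeo.eventually_exists_isGoodStep 0 one_pos EntireDiffeo.refl).and
    (eventually_ge_atTop 2)).exists
  obtain ⟨ε, hε, hεb, hfac⟩ := exists_pos_le_forall_near
    (eventually_factor EntireDiffeo.refl ((0 : ℤ) / q) 0) (b := 1 / 4) (by norm_num)
  exact ⟨⟨EntireDiffeo.refl, 0, q, ε, 1⟩, h2, le_rfl, by simp; omega, hε, one_pos, hq,
    by simpa using hεb, hεb.trans (by norm_num), hfac⟩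

/-- The order of choices avoids circularity: `h` is available from the previous stage and fixes
`H'`; `κ'` follows from the old curve; the denominator is then taken large for all requirements at
once; `ε'` comes last, when the new map is known. -/
lemma exists_step {n : ℕ} {s : Stage} (hs : Admissible n s) :
    ∃ s', Admissible (n + 1) s' ∧ Step n s s' := by
  obtain ⟨h, hh⟩ := hs.exists_step
  have hq2 := hs.two_le_q
  have hq0 : (0 : ℝ) < s.q := by exact_mod_cast (by omega : 0 < s.q)
  have hpn : (0 : ℝ) < (1 / 2 : ℝ) ^ n := by positivity
  have hcomm : h.CommutesWith s.a := hh.commutesWith s.p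
  set H' := h.comp s.H with hH'
  obtain ⟨δ, hδ, hcurve⟩ := exists_modulus (s.H.continuous_curve s.q) hpn
  obtain ⟨δ', hδ', _, _, hmod⟩ := exists_modulus_bound (fun j x => testFn j (H'.torus.symm x))
    (fun j => (testFn j).continuous.comp H'.torus.symm.continuous) n hpn
  -- The limit factor map will be within `2 κ' ≤ δ` of the next one, a distance at which the current
  -- curve moves by at most `(1 / 2) ^ n`.
  set κ' := min (s.κ / 2) (δ / 2)
  have hκ' : 0 < κ' := lt_min (half_pos hs.κ_pos) (half_pos hδ)
  have hQlim : Tendsto (fun m : ℕ => s.q ^ 2 * m) atTop atTop :=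
    tendsto_id.const_mul_atTop' (by positivity)
  have hQinv : Tendsto (fun m : ℕ => 1 / ((s.q ^ 2 * m : ℕ) : ℝ)) atTop (𝓝 0) :=
    (tendsto_const_div_atTop_nhds_zero_nat 1).comp hQlim
  have halim : Tendsto (fun m : ℕ => s.a + 1 / ((s.q ^ 2 * m : ℕ) : ℝ)) atTop (𝓝 s.a) := by
    simpa using hQinv.const_add s.a
  obtain ⟨m, hm1, ⟨h', hh'⟩, hnear, hnear', haε, hmQ⟩ := ((eventually_ge_atTop 1).and
    ((hQlim.eventually (EntireDiffeo.eventually_exists_isGoodStep (n + 1) hκ' H')).and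
    ((halim.eventually (H'.eventually_conj_near s.a (n + 1) hs.ε_pos)).and
    ((halim.neg.eventually (H'.eventually_conj_near (-s.a) (n + 1) hs.ε_pos)).and
    ((hQinv.eventually_le_const hs.ε_pos).and (hQinv.eventually_le_const hδ')))))).exists
  -- This makes `P / Q = p / q + 1 / Q`. The factor `q ^ 2` ensures coprimality through `(1 - p q m)
  -- (1 + p q m) + (p q m) ^ 2 = 1`.
  set Q := s.q ^ 2 * m with hQ
  set P : ℤ := s.p * s.q * m + 1 with hP
  have hQ0 : 0 < Q := by positivity
  have hQ2 : 2 ≤ Q := by nlinarith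
  have hQr : (0 : ℝ) < Q := by exact_mod_cast hQ0
  have ha : (P / Q : ℝ) = s.a + 1 / (Q : ℝ) := by
    have hm0 : (m : ℝ) ≠ 0 := by positivity
    rw [a, hQ, hP]
    push_cast
    field_simp
  have hcop : IsCoprime P (Q : ℤ) := ⟨1 - s.p * s.q * m, s.p ^ 2 * m, by rw [hQ, hP]; push_cast; ring⟩
  -- Three errors of `(1 / 2) ^ n` add up: perturbation of the map, the Riemann sum, and
  -- equidistribution of the circle.
  have havg : ∀ᶠ T : C(Torus, Torus) in
      𝓝 (⟨(H'.conj (P / Q)).torus, (H'.conj (P / Q)).torus.continuous⟩ : C(Torus, Torus)),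
      ∀ j ∈ Finset.range (n + 1), ∀ x,
        |orbitAverage (testFn j) Q T x - ∫ y, testFn j y| ≤ 3 * (1 / 2 : ℝ) ^ n := by
    rw [eventually_all_finset]
    intro j hj
    have hj' : j ≤ n := by
      rw [Finset.mem_range] at hj
      omega
    filter_upwards [eventually_orbitAverage_near (testFn j) Q
      (⟨(H'.conj (P / Q)).torus, (H'.conj (P / Q)).torus.continuous⟩ : C(Torus, Torus)) hpn]
      with T hT x
    have h₁ := hT x
    have h₂ := H'.abs_orbitAverage_conj_sub_le (testFn j) hQ0 hcop
      (fun u v huv => (hmod j hj').2 u v (huv.trans hmQ)) x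
    have h₃ := hh.equidistributed j hj' (H'.torus x).2
    simp only [hH', EntireDiffeo.torus_comp_symm_apply] at h₂
    simp only [ContinuousMap.coe_mk] at h₁
    rw [abs_le] at *
    constructor <;> linarith [h₁.1, h₁.2, h₂.1, h₂.2, h₃.1, h₃.2]
  obtain ⟨ε', hε', hεb, hev⟩ := exists_pos_le_forall_near
    ((eventually_factor H' (P / Q) (n + 1)).and havg)
    (b := min (s.ε / 2) (min (1 / (4 * (Q : ℝ) ^ (n + 1))) ((1 / 2 : ℝ) ^ (n + 1))))
    (lt_min (half_pos hs.ε_pos) (lt_min (by positivity) (by positivity)))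
  refine ⟨⟨H', P, Q, ε', κ'⟩, ⟨hQ2, ?_, ?_, hε', hκ', ⟨h', hh'⟩, ?_, ?_, fun T hT => (hev T hT).1⟩,
    ⟨?_, ?_, hεb.trans (min_le_left _ _), min_le_left _ _, ?_, ?_, ?_, ?_, ?_, ?_⟩⟩
  · have := hs.p_nonneg
    positivity
  · have h1 := hs.p_lt_q
    have h2 : s.p ≤ s.q - 1 := by omega
    have h3 : (2 : ℤ) ≤ s.q := by exact_mod_cast hq2
    have h4 : (1 : ℤ) ≤ m := by exact_mod_cast hm1
    have h5 : s.p * (s.q * m) ≤ (s.q - 1) * (s.q * m) := by gcongr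
    have h6 : (2 : ℤ) ≤ s.q * m := by nlinarith
    simp only [hQ, hP]
    push_cast
    nlinarith
  · exact hεb.trans ((min_le_right _ _).trans (min_le_left _ _))
  · exact hεb.trans ((min_le_right _ _).trans (min_le_right _ _))
  · change s.a < (P / Q : ℝ)
    rw [ha]
    have : 0 < 1 / (Q : ℝ) := by positivity
    linarith
  · change (P / Q : ℝ) ≤ _
    rw [ha]
    gcongr
  · intro z hz
    change ‖(H'.conj (P / Q)).toFun z - (s.H.conj s.a).toFun z‖ ≤ _
    -- Both maps become conjugates by the same `H'`, with rotation numbers that differ by `1 / Q`.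
    rw [← EntireDiffeo.conj_comp_of_commutesWith hcomm, ha]
    exact hnear z hz
  · intro z hz
    change ‖(H'.conj (P / Q)).invFun z - (s.H.conj s.a).invFun z‖ ≤ _
    rw [EntireDiffeo.conj_invFun, EntireDiffeo.conj_invFun,
      ← EntireDiffeo.conj_comp_of_commutesWith hcomm.neg, ha]
    exact hnear' z hz
  · intro x
    change dist (H'.torus x).1 _ ≤ _
    rw [hH', EntireDiffeo.torus_comp_apply]
    exact hh.dist_fst_le _
  · intro u v huv
    refine hcurve u v (huv.trans ?_)
    linarith [min_le_right (s.κ / 2) (δ / 2)]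
  · have := hh.volume_curve_le
    simp only [K, hH', EntireDiffeo.torus_comp_apply]
    exact this
  · exact ⟨Q, hQ0, fun T hT j hj => (hev T hT).2 j (by simp; omega)⟩

lemma exists_stages : ∃ u : ℕ → Stage, (∀ n, Admissible n (u n)) ∧ ∀ n, Step n (u n) (u (n + 1)) :=
  exists_seq_of_forall_exists exists_admissible_zero fun _ _ hs => exists_step hs

end Stage

/-! ### Limits -/

lemma le_geometric {ε : ℕ → ℝ} (hε : ∀ n, ε (n + 1) ≤ ε n / 2) (n : ℕ) :
    ε n ≤ ε 0 * (1 / 2 : ℝ) ^ n := by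
  induction n with
  | zero => simp
  | succ n ih =>
    rw [pow_succ]
    linarith [hε n]

lemma tendsto_zero_of_le_half {ε : ℕ → ℝ} (h0 : ∀ n, 0 ≤ ε n) (hε : ∀ n, ε (n + 1) ≤ ε n / 2) :
    Tendsto ε atTop (𝓝 0) := by
  refine squeeze_zero h0 (le_geometric hε) ?_
  simpa using (tendsto_pow_atTop_nhds_zero_of_lt_one (by norm_num : (0 : ℝ) ≤ 1 / 2)
    (by norm_num)).const_mul (ε 0)

/-- A sequence whose steps are bounded by a sequence that decreases geometrically converges. -/
lemma exists_limit {Y : Type*} [MetricSpace Y] [CompleteSpace Y] {ε : ℕ → ℝ} (h0 : ∀ n, 0 ≤ ε n)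
    (hε : ∀ n, ε (n + 1) ≤ ε n / 2) {x : ℕ → Y} {k : ℕ}
    (hx : ∀ n ≥ k, dist (x (n + 1)) (x n) ≤ ε n) :
    ∃ l, Tendsto x atTop (𝓝 l) ∧ ∀ n ≥ k, dist (x n) l ≤ 2 * ε n := by
  -- The bound telescopes, since `ε n ≤ 2 * ε n - 2 * ε (n + 1)`.
  have hstep : ∀ n ≥ k, ∀ m, dist (x n) (x (n + m)) ≤ 2 * ε n - 2 * ε (n + m) := by
    intro n hn m
    induction m with
    | zero => simp
    | succ m ih =>
      have h1 := hx (n + m) (by omega)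
      have h2 := hε (n + m)
      have h3 := dist_triangle (x n) (x (n + m)) (x (n + m + 1))
      rw [dist_comm (x (n + m))] at h3
      rw [← add_assoc]
      linarith
  have hle : ∀ n ≥ k, ∀ m ≥ n, dist (x n) (x m) ≤ 2 * ε n := by
    intro n hn m hm
    have := hstep n hn (m - n)
    rw [Nat.add_sub_cancel' hm] at this
    linarith [h0 m]
  have hc : CauchySeq x := by
    rw [Metric.cauchySeq_iff']
    intro δ hδ
    have hlim := ((tendsto_zero_of_le_half h0 hε).const_mul 2).eventually_lt_const
      (show 2 * 0 < δ by simpa using hδ)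
    obtain ⟨N, hN, hNk⟩ := (hlim.and (eventually_ge_atTop k)).exists
    refine ⟨N, fun n hn => ?_⟩
    rw [dist_comm]
    exact (hle N hNk n hn).trans_lt hN
  obtain ⟨l, hl⟩ := cauchySeq_tendsto_of_complete hc
  refine ⟨l, hl, fun n hn => ?_⟩
  exact le_of_tendsto (tendsto_const_nhds.dist hl) ((eventually_ge_atTop n).mono (hle n hn))

lemma measurePreserving_of_tendsto {X Y : Type*} [MeasurableSpace X] [TopologicalSpace X]
    [BorelSpace X] [MetricSpace Y] [CompactSpace Y] [MeasurableSpace Y] [BorelSpace Y]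
    {μ : Measure X} [IsProbabilityMeasure μ] {ν : Measure Y} [IsProbabilityMeasure ν]
    {f : ℕ → X → Y} {g : X → Y} (hf : ∀ n, MeasurePreserving (f n) μ ν) (hg : Continuous g)
    (h : ∀ x, Tendsto (fun n => f n x) atTop (𝓝 (g x))) : MeasurePreserving g μ ν := by
  refine ⟨hg.measurable, ?_⟩
  have : IsProbabilityMeasure (μ.map g) := Measure.isProbabilityMeasure_map hg.aemeasurable
  refine ext_of_forall_integral_eq_of_IsFiniteMeasure fun F => ?_
  rw [integral_map hg.aemeasurable F.continuous.measurable.aestronglyMeasurable]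
  have h1 : Tendsto (fun n => ∫ x, F (f n x) ∂μ) atTop (𝓝 (∫ x, F (g x) ∂μ)) := by
    refine tendsto_integral_of_dominated_convergence (fun _ => ‖F‖) (fun n => ?_)
      (integrable_const _) (fun n => ae_of_all _ fun x => F.norm_coe_le_norm _)
      (ae_of_all _ fun x => (F.continuous.tendsto _).comp (h x))
    exact (F.continuous.measurable.comp (hf n).measurable).aestronglyMeasurable
  refine tendsto_nhds_unique h1 ?_
  simp_rw [fun n => (hf n).integral_comp_of_continuous F.continuous]
  exact tendsto_const_nhds

lemma mem_tube_of_le {ρ ρ' : ℝ} (h : ρ ≤ ρ') {z : ℂ × ℂ} (hz : z ∈ tube ρ) : z ∈ tube ρ' :=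
  ⟨hz.1.trans_le h, hz.2.trans_le h⟩

lemma isOpen_tube (ρ : ℝ) : IsOpen (tube ρ) := by
  refine IsOpen.inter ?_ ?_
  · exact isOpen_lt (Complex.continuous_im.comp continuous_fst).abs continuous_const
  · exact isOpen_lt (Complex.continuous_im.comp continuous_snd).abs continuous_const

lemma exists_mem_tube (z : ℂ × ℂ) : ∃ k : ℕ, z ∈ tube (k + 1) := by
  obtain ⟨k, hk⟩ := exists_nat_gt (max |z.1.im| |z.2.im|)
  exact ⟨k, (le_max_left _ _).trans_lt (by linarith), (le_max_right _ _).trans_lt (by linarith)⟩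

lemma tendstoLocallyUniformly_of_tube {Φ : ℕ → ℂ × ℂ → ℂ × ℂ} {Ψ : ℂ × ℂ → ℂ × ℂ} {ε : ℕ → ℝ}
    (hε : Tendsto ε atTop (𝓝 0))
    (h : ∀ n : ℕ, ∀ z ∈ tube (n + 1), dist (Φ n z) (Ψ z) ≤ 2 * ε n) :
    TendstoLocallyUniformly Φ Ψ atTop := by
  rw [Metric.tendstoLocallyUniformly_iff]
  intro δ hδ z
  obtain ⟨k, hk⟩ := exists_mem_tube z
  refine ⟨tube (k + 1), (isOpen_tube _).mem_nhds hk, ?_⟩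
  filter_upwards [(hε.const_mul 2).eventually_lt_const (show 2 * 0 < δ by simpa using hδ),
    eventually_ge_atTop k] with n hn hkn y hy
  rw [dist_comm]
  have hkn' : (k : ℝ) ≤ n := by exact_mod_cast hkn
  exact (h n y (mem_tube_of_le (by linarith) hy)).trans_lt hn

lemma exists_limit_lift {Φ : ℕ → ℂ × ℂ → ℂ × ℂ} (hΦ : ∀ n, IsEntireLift (Φ n)) {ε : ℕ → ℝ}
    (h0 : ∀ n, 0 ≤ ε n) (hε : ∀ n, ε (n + 1) ≤ ε n / 2)
    (h : ∀ n : ℕ, ∀ z ∈ tube (n + 1), ‖Φ (n + 1) z - Φ n z‖ ≤ ε n) :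
    ∃ Ψ, IsEntireLift Ψ ∧ TendstoLocallyUniformly Φ Ψ atTop ∧
      ∀ n : ℕ, ∀ z ∈ tube (n + 1), ‖Φ n z - Ψ z‖ ≤ 2 * ε n := by
  have hlim : ∀ z, ∃ l, Tendsto (fun n => Φ n z) atTop (𝓝 l) ∧
      ∀ n : ℕ, z ∈ tube (n + 1) → dist (Φ n z) l ≤ 2 * ε n := by
    intro z
    -- The estimates hold at `z` only from the index at which the growing tubes contain `z`;
    -- uniqueness of limits makes the choice of `k` immaterial.
    have key : ∀ k : ℕ, z ∈ tube (k + 1) → ∃ l, Tendsto (fun n => Φ n z) atTop (𝓝 l) ∧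
        ∀ n ≥ k, dist (Φ n z) l ≤ 2 * ε n := fun k hk =>
      exists_limit h0 hε fun n hn => by
        have hkn : (k : ℝ) ≤ n := by exact_mod_cast hn
        rw [dist_eq_norm]
        exact h n z (mem_tube_of_le (by linarith) hk)
    obtain ⟨k, hk⟩ := exists_mem_tube z
    obtain ⟨l, hl, -⟩ := key k hk
    refine ⟨l, hl, fun n hn => ?_⟩
    obtain ⟨l', hl', hb⟩ := key n hn
    rw [tendsto_nhds_unique hl hl']
    exact hb n le_rfl
  choose Ψ hΨ hb using hlim
  have hloc := tendstoLocallyUniformly_of_tube (tendsto_zero_of_le_half h0 hε)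
    fun n z hz => hb z n hz
  refine ⟨Ψ, ⟨?_, fun z m n => ?_, fun x y => ⟨?_, ?_⟩⟩, hloc, fun n z hz => ?_⟩
  · have h₁ : TendstoLocallyUniformly (fun n z => (Φ n z).1) (fun z => (Ψ z).1) atTop :=
      uniformContinuous_fst.comp_tendstoLocallyUniformly hloc
    have h₂ : TendstoLocallyUniformly (fun n z => (Φ n z).2) (fun z => (Ψ z).2) atTop :=
      uniformContinuous_snd.comp_tendstoLocallyUniformly hloc
    exact (differentiable_of_tendstoLocallyUniformly (fun n => (hΦ n).differentiable.fst) h₁).prodMk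
      (differentiable_of_tendstoLocallyUniformly (fun n => (hΦ n).differentiable.snd) h₂)
  · refine tendsto_nhds_unique (hΨ _) ?_
    simp_rw [fun k => (hΦ k).equivariant z m n]
    exact ((hΨ z).fst_nhds.add_const _).prodMk_nhds ((hΨ z).snd_nhds.add_const _)
  · refine tendsto_nhds_unique ((Complex.continuous_im.tendsto _).comp (hΨ (x, y)).fst_nhds) ?_
    simp [Function.comp_def, ((hΦ _).real x y).1]
  · refine tendsto_nhds_unique ((Complex.continuous_im.tendsto _).comp (hΨ (x, y)).snd_nhds) ?_
    simp [Function.comp_def, ((hΦ _).real x y).2]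
  · rw [← dist_eq_norm]
    exact hb z n hz

/-- A limit of diffeomorphisms need not be invertible. The inverses are therefore made to converge
as well, and both composition identities pass to the limit by local uniformity. -/
lemma EntireDiffeo.exists_limit (D : ℕ → EntireDiffeo) {ε : ℕ → ℝ}
    (h0 : ∀ n, 0 ≤ ε n) (hε : ∀ n, ε (n + 1) ≤ ε n / 2)
    (h : ∀ n : ℕ, ∀ z ∈ tube (n + 1), ‖(D (n + 1)).toFun z - (D n).toFun z‖ ≤ ε n)
    (h' : ∀ n : ℕ, ∀ z ∈ tube (n + 1), ‖(D (n + 1)).invFun z - (D n).invFun z‖ ≤ ε n) :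
    ∃ T : EntireDiffeo, ∀ n : ℕ, ∀ z ∈ tube (n + 1), ‖(D n).toFun z - T.toFun z‖ ≤ 2 * ε n := by
  obtain ⟨Φ, hΦ, hlocΦ, hΦb⟩ := exists_limit_lift (fun n => (D n).lift) h0 hε h
  obtain ⟨Ψ, hΨ, hlocΨ, -⟩ := exists_limit_lift (fun n => (D n).lift_inv) h0 hε h'
  refine ⟨⟨Φ, Ψ, fun z => ?_, fun z => ?_, hΦ, hΨ, ?_⟩, hΦb⟩
  · have : Tendsto (fun n => (D n).invFun ((D n).toFun z)) atTop (𝓝 (Ψ (Φ z))) :=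
      hlocΨ.tendsto_comp hΨ.differentiable.continuous.continuousAt 
        ((tendstoLocallyUniformlyOn_univ.2 hlocΦ).tendsto_at (Set.mem_univ z))
    simp_rw [(D _).left_inv] at this
    exact tendsto_nhds_unique this tendsto_const_nhds
  · have : Tendsto (fun n => (D n).toFun ((D n).invFun z)) atTop (𝓝 (Φ (Ψ z))) :=
      hlocΦ.tendsto_comp hΦ.differentiable.continuous.continuousAt 
        ((tendstoLocallyUniformlyOn_univ.2 hlocΨ).tendsto_at (Set.mem_univ z))
    simp_rw [(D _).right_inv] at this
    exact tendsto_nhds_unique this tendsto_const_nhds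
  · refine measurePreserving_of_tendsto (fun n => (D n).measurePreserving) hΦ.continuous_torusMap
      fun t => ?_
    rw [tendsto_iff_dist_tendsto_zero]
    refine squeeze_zero (fun _ => dist_nonneg) (fun n => (D n).lift.dist_torusMap_le hΦ
      (by positivity : (0 : ℝ) < n + 1) (hΦb n) t) ?_
    simpa using (tendsto_zero_of_le_half h0 hε).const_mul 2

/-! ### Unique ergodicity and the isomorphism with the rotation -/

lemma integral_orbitAverage {T : Torus → Torus} {ν : Measure Torus} [IsProbabilityMeasure ν]
    (hT : Continuous T) (hν : MeasurePreserving T ν ν) (G : C(Torus, ℝ)) {N : ℕ} (hN : 0 < N) :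
    ∫ x, orbitAverage G N T x ∂ν = ∫ x, G x ∂ν := by
  have hN' : (N : ℝ) ≠ 0 := by exact_mod_cast hN.ne'
  unfold orbitAverage
  have hint : ∀ k, Integrable (fun x => G (T^[k] x)) ν := fun k =>
    (G.continuous.comp (hT.iterate k)).integrable_of_compactSpace ν
  rw [integral_const_mul, integral_finsetSum _ fun k _ => hint k]
  simp_rw [fun k => (hν.iterate k).integral_comp_of_continuous G.continuous]
  rw [Finset.sum_const, Finset.card_range, nsmul_eq_mul, inv_mul_cancel_left₀ hN']

/-- Integrating an orbit average against an invariant `ν` returns the `ν`-integral of the test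
function, while the average is uniformly near the Lebesgue integral. The two agree on a dense set of
functions, hence on all. -/
lemma isUniquelyErgodic_of_average {T : Torus → Torus} (hT : Continuous T)
    (hmp : MeasurePreserving T volume volume)
    (h : ∀ n : ℕ, ∃ N > 0, ∀ j ≤ n, ∀ x,
      |orbitAverage (testFn j) N T x - ∫ y, testFn j y| ≤ 3 * (1 / 2 : ℝ) ^ n) :
    IsUniquelyErgodic T := by
  refine ⟨volume, ⟨inferInstance, hmp⟩, ?_⟩
  rintro ν ⟨hν, hνT⟩
  have htest : ∀ j, ∫ x, testFn j x ∂ν = ∫ x, testFn j x := by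
    intro j
    have hlim : Tendsto (fun n : ℕ => 3 * (1 / 2 : ℝ) ^ n) atTop (𝓝 0) := by
      simpa using (tendsto_pow_atTop_nhds_zero_of_lt_one (by norm_num : (0 : ℝ) ≤ 1 / 2)
        (by norm_num)).const_mul 3
    rw [← sub_eq_zero, ← abs_nonpos_iff]
    refine ge_of_tendsto hlim ((eventually_ge_atTop j).mono fun n hn => ?_)
    obtain ⟨N, hN, hb⟩ := h n
    have hint : Integrable (fun x => orbitAverage (testFn j) N T x) ν := by
      refine Continuous.integrable_of_compactSpace ν ?_
      exact continuous_const.mul (continuous_finsetSum _ fun k _ =>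
        (testFn j).continuous.comp (hT.iterate k))
    have e : ∫ x, testFn j x ∂ν - ∫ x, testFn j x =
        ∫ x, (orbitAverage (testFn j) N T x - ∫ y, testFn j y) ∂ν := by
      rw [integral_sub hint (integrable_const _), integral_orbitAverage hT hνT _ hN]
      simp
    rw [e, ← Real.norm_eq_abs]
    exact (norm_integral_le_of_norm_le_const (ae_of_all _ fun x => hb j hn x)).trans (by simp)
  have hcont : ∀ (ν : Measure Torus) [IsProbabilityMeasure ν],
      Continuous fun G : C(Torus, ℝ) => ∫ x, G x ∂ν := by
    intro ν _
    refine LipschitzWith.continuous (K := 1) (LipschitzWith.of_dist_le_mul fun G G' => ?_)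
    rw [Real.dist_eq, ← integral_sub (G.continuous.integrable_of_compactSpace ν)
      (G'.continuous.integrable_of_compactSpace ν), ← Real.norm_eq_abs]
    refine (norm_integral_le_of_norm_le_const (C := dist G G')
      (ae_of_all _ fun x => ?_)).trans (by simp)
    rw [← dist_eq_norm]
    exact ContinuousMap.dist_apply_le_dist x
  have hall : (fun G : C(Torus, ℝ) => ∫ x, G x ∂ν) = fun G => ∫ x, G x :=
    (hcont ν).ext_on (TopologicalSpace.denseRange_denseSeq C(Torus, ℝ)) (hcont volume) (by
      rintro _ ⟨j, rfl⟩
      exact htest j)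
  exact ext_of_forall_integral_eq_of_IsFiniteMeasure fun F =>
    congrFun hall F.toContinuousMap

/-- A measure-preserving semiconjugacy that can be recovered almost everywhere from approximate
inverses is an isomorphism. -/
lemma metricallyIsomorphic_of_approximate_inverse {X Y : Type*} [MeasurableSpace X]
    [MetricSpace X] [CompactSpace X] [BorelSpace X] [Nonempty X] [MeasurableSpace Y] [MeasurableEq Y]
    {μ : Measure X} {ν : Measure Y} {T : X → X} {S : Y → Y} {K : X → Y} {L : ℕ → Y → X}
    (hK : MeasurePreserving K μ ν) (hL : ∀ n, Measurable (L n)) (hKT : ∀ x, K (T x) = S (K x))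
    (hLK : ∀ᵐ x ∂μ, Tendsto (fun n => L n (K x)) atTop (𝓝 x)) :
    MetricallyIsomorphic μ T ν S := by
  -- The set of convergence is measurable, so the almost sure statement on `X` transfers to `Y`
  -- through the push-forward by `K`.
  have hex : ∀ᵐ y ∂ν, ∃ l, Tendsto (fun n => L n y) atTop (𝓝 l) := by
    rw [← hK.map_eq, ae_map_iff hK.aemeasurable (measurableSet_exists_tendsto hL)]
    exact hLK.mono fun x hx => ⟨x, hx⟩
  obtain ⟨L', hL'm, hL'⟩ := measurable_limit_of_tendsto_metrizable_ae
    (fun n => (hL n).aemeasurable) hex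
  have hinv : ∀ᵐ x ∂μ, L' (K x) = x := by
    filter_upwards [hLK, hK.quasiMeasurePreserving.ae hL'] with x h1 h2
    exact tendsto_nhds_unique h2 h1
  have hL'mp : MeasurePreserving L' ν μ := by
    refine ⟨hL'm, ?_⟩
    rw [← hK.map_eq, Measure.map_map hL'm hK.measurable]
    exact (Measure.map_congr hinv).trans Measure.map_id
  refine ⟨K, L', hK, hL'mp, hinv, ?_, ae_of_all _ hKT⟩
  have hm : MeasurableSet {y | K (L' y) = y} :=
    measurableSet_eq_fun (hK.measurable.comp hL'm) measurable_id
  rw [← hK.map_eq, ae_map_iff hK.aemeasurable hm]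
  filter_upwards [hinv] with x hx
  rw [hx]

/-! ### The limit of the construction -/

namespace Stage

variable {u : ℕ → Stage}

lemma exists_limit_T (hu : ∀ n, Admissible n (u n)) (hs : ∀ n, Step n (u n) (u (n + 1))) :
    ∃ T : EntireDiffeo, ∀ n : ℕ, ∀ z ∈ tube (n + 1),
      ‖(u n).T.toFun z - T.toFun z‖ ≤ 2 * (u n).ε :=
  EntireDiffeo.exists_limit (fun n => (u n).T) (fun n => (hu n).ε_pos.le)
    (fun n => (hs n).ε_le_half) (fun n => (hs n).toFun_near) (fun n => (hs n).invFun_near)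

/-- The distance from `p / q` to `α` is at most `2 ε ≤ 1 / (2 q ^ n)`, and it is nonzero because the
rotation numbers increase strictly. -/
lemma exists_limit_a (hu : ∀ n, Admissible n (u n)) (hs : ∀ n, Step n (u n) (u (n + 1))) :
    ∃ α : ℝ, Tendsto (fun n => (u n).a) atTop (𝓝 α) ∧ Liouville α := by
  have hmono : StrictMono fun n => (u n).a := strictMono_nat_of_lt_succ fun n => (hs n).a_lt
  obtain ⟨α, hα, hb⟩ := exists_limit (k := 0) (fun n => (hu n).ε_pos.le)
    (fun n => (hs n).ε_le_half) (x := fun n => (u n).a) fun n _ => by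
      rw [Real.dist_eq, abs_of_pos (sub_pos.2 (hs n).a_lt)]
      linarith [(hs n).a_le]
  refine ⟨α, hα, fun n => ⟨(u n).p, (u n).q, ?_, ?_, ?_⟩⟩
  · have := (hu n).two_le_q
    omega
  · have h1 : (u (n + 1)).a ≤ α := hmono.monotone.ge_of_tendsto hα _
    have h2 := (hs n).a_lt
    exact ne_of_gt (h2.trans_le h1)
  · have h1 := hb n (Nat.zero_le n)
    rw [dist_comm, Real.dist_eq] at h1
    have hq : (0 : ℝ) < (u n).q := by
      have := (hu n).two_le_q
      positivity
    have h2 := (hu n).ε_le_q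
    have h3 : 1 / (4 * ((u n).q : ℝ) ^ n) = 1 / ((u n).q : ℝ) ^ n / 4 := by
      field_simp
    have h4 : 0 < 1 / ((u n).q : ℝ) ^ n := by positivity
    change |α - (u n).a| < _
    rw [Int.cast_natCast]
    linarith

lemma exists_limit_K (hu : ∀ n, Admissible n (u n)) (hs : ∀ n, Step n (u n) (u (n + 1))) :
    ∃ K : Torus → UnitAddCircle, (∀ x, Tendsto (fun n => (u n).K x) atTop (𝓝 (K x))) ∧
      (∀ n x, dist ((u n).K x) (K x) ≤ 2 * (u n).κ) ∧ MeasurePreserving K volume volume := by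
  have h0 : ∀ n, 0 ≤ (u n).κ := fun n => (hu n).κ_pos.le
  have hhalf : ∀ n, (u (n + 1)).κ ≤ (u n).κ / 2 := fun n => (hs n).κ_le_half
  choose K hK hb using fun x => exists_limit (k := 0) h0 hhalf (x := fun n => (u n).K x)
    fun n _ => (hs n).K_near x
  refine ⟨K, hK, fun n x => hb x n (Nat.zero_le n), ?_⟩
  refine measurePreserving_of_tendsto (fun n => (u n).measurePreserving_K) ?_ hK
  have hunif : TendstoUniformly (fun n => (u n).K) K atTop := by
    rw [Metric.tendstoUniformly_iff]
    intro δ hδ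
    filter_upwards [((tendsto_zero_of_le_half h0 hhalf).const_mul 2).eventually_lt_const
      (show 2 * 0 < δ by simpa using hδ)] with n hn x
    rw [dist_comm]
    exact (hb x n (Nat.zero_le n)).trans_lt hn
  exact hunif.continuous (Eventually.of_forall fun n => (u n).continuous_K).frequently

/-- The exceptional sets have summable measure, so by Borel–Cantelli almost every `x` lies in
finitely many of them. Replacing the next factor map by `K` moves the curve point by at most another
`(1 / 2) ^ n`. -/
lemma ae_tendsto_curve (hs : ∀ n, Step n (u n) (u (n + 1))) {K : Torus → UnitAddCircle}
    (hK : ∀ n x, dist ((u n).K x) (K x) ≤ 2 * (u n).κ) :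
    ∀ᵐ x, Tendsto (fun n => (u n).H.curve (u n).q (K x)) atTop (𝓝 x) := by
  have hsum : ∑' n : ℕ, volume {x | (1 / 2 : ℝ) ^ n <
      dist ((u n).H.curve (u n).q ((u (n + 1)).K x)) x} ≠ ∞ := by
    refine ne_top_of_le_ne_top ?_ (ENNReal.tsum_le_tsum fun n => (hs n).volume_curve_le)
    exact (summable_geometric_of_lt_one (by norm_num) (by norm_num)).tsum_ofReal_ne_top
  filter_upwards [ae_eventually_notMem hsum] with x hx
  rw [tendsto_iff_dist_tendsto_zero]
  have hlim : Tendsto (fun n : ℕ => 2 * (1 / 2 : ℝ) ^ n) atTop (𝓝 0) := by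
    simpa using (tendsto_pow_atTop_nhds_zero_of_lt_one (by norm_num : (0 : ℝ) ≤ 1 / 2)
      (by norm_num)).const_mul 2
  refine squeeze_zero' (Eventually.of_forall fun _ => dist_nonneg) ?_ hlim
  filter_upwards [hx] with n hn
  have h1 : dist ((u n).H.curve (u n).q ((u (n + 1)).K x)) x ≤ (1 / 2 : ℝ) ^ n := not_lt.1 hn
  have h2 := (hs n).curve_near _ _ (hK (n + 1) x)
  rw [dist_comm] at h2
  linarith [dist_triangle ((u n).H.curve (u n).q (K x))
    ((u n).H.curve (u n).q ((u (n + 1)).K x)) x]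

/-- The limit map `T` lies in the room left by every stage, so the approximate semiconjugacy of each
stage holds for `T` itself, with error tending to zero. -/
lemma semiconj_limit (hu : ∀ n, Admissible n (u n)) {T : C(Torus, Torus)} {α : ℝ}
    {K : Torus → UnitAddCircle} (hT : ∀ n x, dist (T x) ((u n).T.torus x) ≤ 2 * (u n).ε)
    (hα : Tendsto (fun n => (u n).a) atTop (𝓝 α))
    (hK : ∀ x, Tendsto (fun n => (u n).K x) atTop (𝓝 (K x))) (x : Torus) :
    K (T x) = rotation α (K x) := by
  have hα' : Tendsto (fun n => ((u n).a : UnitAddCircle)) atTop (𝓝 (α : UnitAddCircle)) :=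
    ((AddCircle.continuous_mk' 1).tendsto α).comp hα
  have h1 : Tendsto (fun n => dist ((u n).K (T x)) ((u n).K x + ((u n).a : UnitAddCircle))) atTop
      (𝓝 (dist (K (T x)) (K x + (α : UnitAddCircle)))) :=
    (hK (T x)).dist ((hK x).add hα')
  have h2 : Tendsto (fun n => dist ((u n).K (T x)) ((u n).K x + ((u n).a : UnitAddCircle))) atTop
      (𝓝 0) :=
    squeeze_zero (fun _ => dist_nonneg) (fun n => (hu n).factor T (hT n) x)
      (tendsto_pow_atTop_nhds_zero_of_lt_one (by norm_num) (by norm_num))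
  exact dist_eq_zero.1 (tendsto_nhds_unique h1 h2)

end Stage

end AnalyticTorus

end

/-! ### Assembly of the theorem -/

open AnalyticTorus

theorem mainTheorem1 :
    ∃ (α : ℝ) (T : AnalyticTorus.Torus ≃ AnalyticTorus.Torus),
      Irrational α ∧ Liouville α ∧
      AnalyticTorus.IsAnalyticDiffeo T ∧ AnalyticTorus.IsEntire T ∧
      MeasurePreserving T volume volume ∧
      AnalyticTorus.IsUniquelyErgodic T ∧
      AnalyticTorus.MetricallyIsomorphic volume T volume (AnalyticTorus.rotation α) ∧
      (∀ ρ : ℝ, 0 < ρ → T ∈ AnalyticTorus.DiffRho ρ) ∧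
      ∃ (a : ℕ → ℚ) (H Tn : ℕ → (AnalyticTorus.Torus ≃ AnalyticTorus.Torus)),
        (∀ n, 0 ≤ a n ∧ a n < 1) ∧
        Tendsto (fun n => (a n : ℝ)) atTop (𝓝 α) ∧
        (∀ n, ∀ ρ : ℝ, 0 < ρ → H n ∈ AnalyticTorus.DiffRho ρ) ∧
        (∀ n, ∀ x, Tn n x = (H n).symm (AnalyticTorus.flow (a n : ℝ) (H n x))) ∧
        (∀ n, ∀ ρ : ℝ, 0 < ρ → Tn n ∈ AnalyticTorus.DiffRho ρ) ∧
        ∀ ρ : ℝ, 0 < ρ →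
          Tendsto (fun n => AnalyticTorus.distRho ρ (Tn n) T) atTop (𝓝 0) := by
  obtain ⟨u, hu, hs⟩ := Stage.exists_stages
  obtain ⟨T, hT⟩ := Stage.exists_limit_T hu hs
  obtain ⟨α, hα, hLiouville⟩ := Stage.exists_limit_a hu hs
  obtain ⟨K, hK, hKb, hKmp⟩ := Stage.exists_limit_K hu hs
  have hdist : ∀ n x, dist (T.torus x) ((u n).T.torus x) ≤ 2 * (u n).ε := fun n x => by
    rw [dist_comm]
    exact (u n).T.lift.dist_torusMap_le T.lift (by positivity : (0 : ℝ) < n + 1) (hT n) x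
  let T' : C(Torus, Torus) := ⟨T.torus, T.torus.continuous⟩
  have ha : ∀ n, (((u n).p / (u n).q : ℚ) : ℝ) = (u n).a := fun n => by
    rw [Stage.a]
    push_cast
    rfl
  refine ⟨α, T.torus.toEquiv, hLiouville.irrational, hLiouville, T.isAnalyticDiffeo, T.isEntire,
    T.mp, isUniquelyErgodic_of_average T.torus.continuous T.mp fun n => ?_,
    metricallyIsomorphic_of_approximate_inverse hKmp
      (fun n => ((u n).H.continuous_curve (u n).q).measurable)
      (fun x => Stage.semiconj_limit (T := T') hu hdist hα hK x) (Stage.ae_tendsto_curve hs hKb),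
    fun ρ _ => T.mem_diffRho ρ, fun n => (u n).p / (u n).q, fun n => (u n).H.torus.toEquiv,
    fun n => (u n).T.torus.toEquiv, fun n => ?_, ?_, fun n ρ _ => (u n).H.mem_diffRho ρ,
    fun n x => ?_, fun n ρ _ => (u n).T.mem_diffRho ρ, fun ρ _ => ?_⟩
  · obtain ⟨N, hN, h⟩ := (hs n).average
    -- The step from `n` controls averages near the map of stage `n + 1`, hence the shifted index.
    exact ⟨N, hN, fun j hj x => h T' (hdist (n + 1)) j hj x⟩
  · have hq : (0 : ℚ) < (u n).q := by
      have := (hu n).two_le_q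
      positivity
    refine ⟨div_nonneg (by exact_mod_cast (hu n).p_nonneg) hq.le, ?_⟩
    rw [div_lt_one hq]
    exact_mod_cast (hu n).p_lt_q
  · simp_rw [ha]
    exact hα
  · rw [ha]
    exact (u n).H.conj_torus (u n).a x
  · have hlim : Tendsto (fun n => ENNReal.ofReal (2 * (u n).ε)) atTop (𝓝 0) := by
      have := (tendsto_zero_of_le_half (fun n => (hu n).ε_pos.le)
        (fun n => (hs n).ε_le_half)).const_mul 2
      rw [mul_zero] at this
      simpa using ENNReal.tendsto_ofReal this
    refine tendsto_of_tendsto_of_tendsto_of_le_of_le' tendsto_const_nhds hlim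
      (Eventually.of_forall fun _ => zero_le) ?_
    obtain ⟨k, hk⟩ := exists_nat_gt ρ
    filter_upwards [eventually_ge_atTop k] with n hn
    have hkn : (k : ℝ) ≤ n := by exact_mod_cast hn
    exact (u n).T.lift.distRho_le T.lift rfl rfl fun z hz =>
      hT n z (mem_tube_of_le (by linarith) hz)
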